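/- Let $d\ge 0$ be an integer, let $a,b>0$, let $\Lambda=a\mathbb Z^d\times b\mathbb Z^d\subset\mathbb R^{2d}$, and let $0<\varepsilon<\min\{\frac1{2a},\frac1{2b}\}$. Put $$Q_\varepsilon=\Big[-\tfrac1{2a}+\varepsilon,\tfrac1{2a}-\varepsilon\Big]^d\times\Big[-\tfrac1{2b}+\varepsilon,\tfrac1{2b}-\varepsilon\Big]^d,\qquad Q=\Big[-\tfrac1{2a},\tfrac1{2a}\Big]^d\times\Big[-\tfrac1{2b},\tfrac1{2b}\Big]^d .$$ The Fourier transform is normalised as $\hat f(\xi)=\mathcal Ff(\xi)=\int f(x)e^{-2\pi i x\cdot\xi}\,dx$ and extended to tempered distributions. Write $T_xf(t)=f(t-x)$, $\pi(x,\xi)f(t)=e^{2\pi i\xi\cdot t}f(t-x)$, $V_gf(x,\xi)=\int f(t)\overline{g(t-x)}e^{-2\pi i\xi\cdot t}\,dt$, $\mathcal UF(\xi,x)=F(-x,\xi)$ and $R(f,g)(x,\xi)=f(x)\overline{\hat g(\xi)}e^{-2\pi i x\cdot\xi}$. For a symbol $\sigma\in\mathcal S'(\mathbb R^{2d})$ the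 Kohn-Nirenberg operator $\sigma^{KN}:\mathcal S(\mathbb R^d)\to\mathcal S'(\mathbb R^d)$ is defined by $\langle\sigma^{KN}f,h\rangle=\langle\sigma,R(h,f)\rangle$ for $f,h\in\mathcal S(\mathbb R^d)$, where $\langle\cdot,\cdot\rangle$ is antilinear in the second argument. Let $\sigma\in\mathcal S'(\mathbb R^{2d})$ with $\operatorname{supp}\hat\sigma\subseteq Q_\varepsilon$, let $g\in\mathcal S(\mathbb R^d)$, and let $\varphi\in C_c^\infty(\mathbb R^{2d})$ satisfy $\varphi=1$ on $Q_\varepsilon$ and $\operatorname{supp}\varphi\subseteq Q$. Assume that $\overline{\mathcal UV_gg}$ does not vanish on $\operatorname{supp}\varphi$. Then the function $$K=\mathcal F^{-1}\Big(\frac{\varphi}{\overline{\mathcal UV_gg}}\Big)$$ (the quotient being $0$ off $\operatorname{supp}\varphi$) belongs to $\mathcal S(\mathbb R^{2d})$, and $\sigma$ is recovered from the diagonal entries $H_{\lambda\lambda}=\langle\sigma^{KN}\pi(\lambda)g,\pi(\lambda)g\rangle$ of the channel matrix by $$\sigma=(ab)^d\sum_{\lambda\in\Lambda}H_{\lambda\lambda}\,T_\lambda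 K ,$$ where the series converges unconditionally in the sense of tempered distributions (that is, after pairing with any Schwartz function on $\mathbb R^{2d}$). -/

import Mathlib

open SchwartzMap FourierTransform MeasureTheory
open scoped ContDiff ComplexConjugate

noncomputable section

namespace ChannelSampling

/-- `ℝ^d` with its Euclidean structure. -/
abbrev Space (d : ℕ) := EuclideanSpace ℝ (Fin d)

/-- The phase space `ℝ^{2d} = ℝ^d × ℝ^d` with its Euclidean structure: the coordinates `Sum.inl i`
are those of the first factor, the coordinates `Sum.inr i` those of the second one. -/
abbrev Phase (d : ℕ) := EuclideanSpace ℝ (Fin d ⊕ Fin d)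

variable {d : ℕ}

/-- The projection `(x, ξ) ↦ x`. -/
def proj₁ : Phase d →L[ℝ] Space d :=
  (EuclideanSpace.equiv (Fin d) ℝ).symm.toContinuousLinearMap ∘L
    ContinuousLinearMap.pi fun i => EuclideanSpace.proj (Sum.inl i)

/-- The projection `(x, ξ) ↦ ξ`. -/
def proj₂ : Phase d →L[ℝ] Space d :=
  (EuclideanSpace.equiv (Fin d) ℝ).symm.toContinuousLinearMap ∘L
    ContinuousLinearMap.pi fun i => EuclideanSpace.proj (Sum.inr i)

@[simp] theorem proj₁_apply (z : Phase d) (i : Fin d) : proj₁ z i = z (Sum.inl i) := rfl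

@[simp] theorem proj₂_apply (z : Phase d) (i : Fin d) : proj₂ z i = z (Sum.inr i) := rfl

/-- The point `(x, ξ)` of phase space. -/
def pair (x ξ : Space d) : Phase d := WithLp.toLp 2 (Sum.elim x ξ)

theorem norm_sq_eq (z : Phase d) : ‖z‖ ^ 2 = ‖proj₁ z‖ ^ 2 + ‖proj₂ z‖ ^ 2 := by
  simp [EuclideanSpace.norm_sq_eq, Fintype.sum_sum_type]

theorem norm_proj₁_le (z : Phase d) : ‖proj₁ z‖ ≤ ‖z‖ := by
  have h := norm_sq_eq z
  exact le_of_sq_le_sq (by nlinarith [sq_nonneg ‖proj₂ z‖]) (norm_nonneg _)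

theorem norm_proj₂_le (z : Phase d) : ‖proj₂ z‖ ≤ ‖z‖ := by
  have h := norm_sq_eq z
  exact le_of_sq_le_sq (by nlinarith [sq_nonneg ‖proj₁ z‖]) (norm_nonneg _)

theorem opNorm_proj₁_le : ‖(proj₁ : Phase d →L[ℝ] Space d)‖ ≤ 1 :=
  ContinuousLinearMap.opNorm_le_bound _ zero_le_one fun z => by simpa using norm_proj₁_le z

theorem opNorm_proj₂_le : ‖(proj₂ : Phase d →L[ℝ] Space d)‖ ≤ 1 :=
  ContinuousLinearMap.opNorm_le_bound _ zero_le_one fun z => by simpa using norm_proj₂_le z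

theorem norm_pow_le (z : Phase d) (k : ℕ) :
    ‖z‖ ^ k ≤ 2 ^ k * (‖proj₁ z‖ ^ k + ‖proj₂ z‖ ^ k) := by
  have h := norm_sq_eq z
  have h1 := norm_nonneg (proj₁ z)
  have h2 := norm_nonneg (proj₂ z)
  have hz : ‖z‖ ≤ ‖proj₁ z‖ + ‖proj₂ z‖ :=
    le_of_sq_le_sq (by nlinarith [mul_nonneg h1 h2]) (by positivity)
  rcases le_total ‖proj₁ z‖ ‖proj₂ z‖ with h' | h'
  · calc ‖z‖ ^ k ≤ (2 * ‖proj₂ z‖) ^ k := by gcongr; linarith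
      _ = 2 ^ k * ‖proj₂ z‖ ^ k := mul_pow _ _ _
      _ ≤ _ := by gcongr; linarith [pow_nonneg h1 k]
  · calc ‖z‖ ^ k ≤ (2 * ‖proj₁ z‖) ^ k := by gcongr; linarith
      _ = 2 ^ k * ‖proj₁ z‖ ^ k := mul_pow _ _ _
      _ ≤ _ := by gcongr; linarith [pow_nonneg h2 k]

/-! ### Operations on Schwartz functions -/

/-- The oscillating factor `e^{2πi q}` has temperate growth if the real phase `q` does. -/
theorem hasTemperateGrowth_cexp {E : Type*} [NormedAddCommGroup E] [NormedSpace ℝ E] {q : E → ℝ}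
    (hq : q.HasTemperateGrowth) :
    (fun z => Complex.exp (2 * Real.pi * Complex.I * q z)).HasTemperateGrowth := by
  have key : (fun t : ℝ => Complex.exp (2 * Real.pi * Complex.I * t)).HasTemperateGrowth := by
    have hd : ∀ n : ℕ, iteratedDeriv n (fun t : ℝ => Complex.exp (2 * Real.pi * Complex.I * t)) =
        fun t : ℝ => (2 * Real.pi * Complex.I) ^ n *
          Complex.exp (2 * Real.pi * Complex.I * t) := by
      intro n
      induction n with
      | zero => simp
      | succ n ih =>
        rw [iteratedDeriv_succ, ih]
        funext t
        have h1 : HasDerivAt (fun t : ℝ => 2 * Real.pi * Complex.I * (t : ℂ))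
            (2 * Real.pi * Complex.I) t := by
          simpa using (Complex.ofRealCLM.hasDerivAt (x := t)).const_mul (2 * Real.pi * Complex.I)
        rw [(h1.cexp.const_mul ((2 * Real.pi * Complex.I) ^ n)).deriv]
        ring
    refine ⟨(contDiff_const.mul Complex.ofRealCLM.contDiff).cexp, fun n => ⟨0, (2 * Real.pi) ^ n, fun t => ?_⟩⟩
    rw [norm_iteratedFDeriv_eq_norm_iteratedDeriv, hd]
    have : ‖Complex.exp (2 * Real.pi * Complex.I * t)‖ = 1 := by
      rw [Complex.norm_exp]; simp
    simp [this, abs_of_pos Real.pi_pos]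
  exact key.comp hq

/-- Pointwise complex conjugation of a Schwartz function. -/
def conjS {E : Type*} [NormedAddCommGroup E] [NormedSpace ℝ E] : 𝓢(E, ℂ) →L[ℝ] 𝓢(E, ℂ) :=
  SchwartzMap.postcompCLM (𝕜 := ℝ) Complex.conjCLE.toContinuousLinearMap

@[simp] theorem conjS_apply {E : Type*} [NormedAddCommGroup E] [NormedSpace ℝ E]
    (f : 𝓢(E, ℂ)) (x : E) : conjS f x = conj (f x) := rfl

/-- Translation `T_x f(t) = f(t - x)`. -/
def translate {E : Type*} [NormedAddCommGroup E] [NormedSpace ℝ E] (x : E) :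
    𝓢(E, ℂ) →L[ℂ] 𝓢(E, ℂ) :=
  SchwartzMap.compSubConstCLM ℂ x

@[simp] theorem translate_apply {E : Type*} [NormedAddCommGroup E] [NormedSpace ℝ E]
    (x : E) (f : 𝓢(E, ℂ)) (t : E) : translate x f t = f (t - x) := rfl

/-- Modulation `M_ξ f(t) = e^{2πi ξ·t} f(t)`. -/
def modulate (ξ : Space d) : 𝓢(Space d, ℂ) →L[ℂ] 𝓢(Space d, ℂ) :=
  SchwartzMap.smulLeftCLM ℂ fun t => Complex.exp (2 * Real.pi * Complex.I * (inner ℝ ξ t : ℝ))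

@[simp] theorem modulate_apply (ξ : Space d) (f : 𝓢(Space d, ℂ)) (t : Space d) :
    modulate ξ f t = Complex.exp (2 * Real.pi * Complex.I * (inner ℝ ξ t : ℝ)) * f t := by
  have h : (fun t : Space d => (inner ℝ ξ t : ℝ)).HasTemperateGrowth := by fun_prop
  simp [modulate, SchwartzMap.smulLeftCLM_apply_apply (hasTemperateGrowth_cexp h)]

/-- The time-frequency shift `π(z) = M_ξ T_x`, `z = (x, ξ)`. -/
def tfShift (z : Phase d) : 𝓢(Space d, ℂ) →L[ℂ] 𝓢(Space d, ℂ) :=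
  modulate (proj₂ z) ∘L translate (proj₁ z)

@[simp] theorem tfShift_apply (z : Phase d) (f : 𝓢(Space d, ℂ)) (t : Space d) :
    tfShift z f t =
      Complex.exp (2 * Real.pi * Complex.I * (inner ℝ (proj₂ z) t : ℝ)) * f (t - proj₁ z) := by
  simp [tfShift]

theorem norm_iteratedFDeriv_comp_proj_le (L : Phase d →L[ℝ] Space d) (hL : ‖L‖ ≤ 1)
    (f : 𝓢(Space d, ℂ)) (n : ℕ) (z : Phase d) :
    ‖iteratedFDeriv ℝ n (fun w => f (L w)) z‖ ≤ ‖iteratedFDeriv ℝ n f (L z)‖ := by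
  have h := L.iteratedFDeriv_comp_right (f := f) (f.smooth ⊤) z (i := n) (mod_cast le_top)
  change ‖iteratedFDeriv ℝ n (f ∘ L) z‖ ≤ _
  rw [h]
  refine (ContinuousMultilinearMap.norm_compContinuousLinearMap_le _ _).trans ?_
  refine mul_le_of_le_one_right (norm_nonneg _) ?_
  exact Finset.prod_le_one (fun _ _ => norm_nonneg _) fun _ _ => hL

/-- The tensor product `(f ⊗ h)(x, ξ) = f(x) h(ξ)`, continuous and linear in `f`. -/
def tensor (h : 𝓢(Space d, ℂ)) : 𝓢(Space d, ℂ) →L[ℂ] 𝓢(Phase d, ℂ) :=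
  SchwartzMap.mkCLM (fun f z => f (proj₁ z) * h (proj₂ z))
    (fun f g z => by simp [add_mul]) (fun c f z => by simp [mul_assoc])
    (fun f => ((f.smooth ⊤).comp proj₁.contDiff).mul ((h.smooth ⊤).comp proj₂.contDiff)) <| by
  rintro ⟨k, n⟩
  refine ⟨Finset.range (k + 1) ×ˢ Finset.range (n + 1),
    ∑ i ∈ Finset.range (n + 1), (n.choose i : ℝ) * (2 ^ k *
      (SchwartzMap.seminorm ℂ 0 (n - i) h + SchwartzMap.seminorm ℂ k (n - i) h)),
    by positivity, fun f z => ?_⟩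
  set S := (Finset.range (k + 1) ×ˢ Finset.range (n + 1)).sup
    (schwartzSeminormFamily ℂ (Space d) ℂ) f with hS
  have hS' : ∀ j ≤ k, ∀ i ≤ n, SchwartzMap.seminorm ℂ j i f ≤ S := fun j hj i hi =>
    Seminorm.le_def.mp (Finset.le_sup (f := schwartzSeminormFamily ℂ (Space d) ℂ)
      (b := (j, i)) (by simp; omega)) f
  have hmul := norm_iteratedFDeriv_mul_le (𝕜 := ℝ) (N := ∞)
    ((f.smooth ⊤).comp (proj₁ (d := d)).contDiff) ((h.smooth ⊤).comp (proj₂ (d := d)).contDiff) z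
    (n := n) (mod_cast le_top)
  refine (mul_le_mul_of_nonneg_left hmul (by positivity)).trans ?_
  rw [Finset.mul_sum, Finset.sum_mul]
  refine Finset.sum_le_sum fun i hi => ?_
  have hi' : i ≤ n := by simpa [Nat.lt_succ_iff] using hi
  have hf := norm_iteratedFDeriv_comp_proj_le proj₁ opNorm_proj₁_le f i z
  have hh := norm_iteratedFDeriv_comp_proj_le proj₂ opNorm_proj₂_le h (n - i) z
  have f0 := (SchwartzMap.norm_iteratedFDeriv_le_seminorm ℂ f i (proj₁ z)).trans
    (hS' 0 (Nat.zero_le _) i hi')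
  have fk := (SchwartzMap.le_seminorm ℂ k i f (proj₁ z)).trans (hS' k le_rfl i hi')
  have h0 := SchwartzMap.norm_iteratedFDeriv_le_seminorm ℂ h (n - i) (proj₂ z)
  have hk := SchwartzMap.le_seminorm ℂ k (n - i) h (proj₂ z)
  set A := ‖iteratedFDeriv ℝ i f (proj₁ z)‖
  set B := ‖iteratedFDeriv ℝ (n - i) h (proj₂ z)‖
  have hS0 : 0 ≤ S := apply_nonneg _ _
  calc ‖z‖ ^ k * ((n.choose i : ℝ) * ‖iteratedFDeriv ℝ i (f ∘ proj₁) z‖ *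
        ‖iteratedFDeriv ℝ (n - i) (h ∘ proj₂) z‖)
      ≤ (2 ^ k * (‖proj₁ z‖ ^ k + ‖proj₂ z‖ ^ k)) * ((n.choose i : ℝ) * A * B) := by
        gcongr
        · exact norm_pow_le z k
        · exact hf
        · exact hh
    _ = (n.choose i : ℝ) * (2 ^ k *
          ((‖proj₁ z‖ ^ k * A) * B + A * (‖proj₂ z‖ ^ k * B))) := by ring
    _ ≤ (n.choose i : ℝ) * (2 ^ k *
          (S * SchwartzMap.seminorm ℂ 0 (n - i) h + S * SchwartzMap.seminorm ℂ k (n - i) h)) := by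
        gcongr
    _ = _ := by ring

@[simp] theorem tensor_apply (h f : 𝓢(Space d, ℂ)) (z : Phase d) :
    tensor h f z = f (proj₁ z) * h (proj₂ z) := rfl

/-- The Rihaczek distribution `R(f, g)(x, ξ) = f(x) \overline{ĝ(ξ)} e^{-2πi x·ξ}` of two Schwartz
functions, as a Schwartz function on phase space. -/
def rihaczek (f g : 𝓢(Space d, ℂ)) : 𝓢(Phase d, ℂ) :=
  SchwartzMap.smulLeftCLM ℂ
    (fun z : Phase d =>
      Complex.exp (2 * Real.pi * Complex.I * (-inner ℝ (proj₁ z) (proj₂ z) : ℝ)))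
    (tensor (conjS (𝓕 g)) f)

theorem hasTemperateGrowth_phase :
    (fun z : Phase d => Complex.exp (2 * Real.pi * Complex.I *
      (-inner ℝ (proj₁ z) (proj₂ z) : ℝ))).HasTemperateGrowth := by
  refine hasTemperateGrowth_cexp (q := fun z : Phase d => -inner ℝ (proj₁ z) (proj₂ z)) ?_
  refine Function.HasTemperateGrowth.neg ?_
  exact (innerSL ℝ (E := Space d)).bilinear_hasTemperateGrowth
    (proj₁ (d := d)).hasTemperateGrowth (proj₂ (d := d)).hasTemperateGrowth

@[simp] theorem rihaczek_apply (f g : 𝓢(Space d, ℂ)) (z : Phase d) :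
    rihaczek f g z = f (proj₁ z) * conj (𝓕 g (proj₂ z)) *
      Complex.exp (-(2 * Real.pi * Complex.I * (inner ℝ (proj₁ z) (proj₂ z) : ℝ))) := by
  rw [rihaczek, SchwartzMap.smulLeftCLM_apply_apply hasTemperateGrowth_phase]
  simp only [tensor_apply, conjS_apply, smul_eq_mul, Complex.ofReal_neg, mul_neg]
  ring

/-- The sesquilinear bracket `⟨u, g⟩` of a tempered distribution and a Schwartz function, linear in
`u` and antilinear in `g`; it extends `∫ u \overline g`. -/
def bracket {E : Type*} [NormedAddCommGroup E] [NormedSpace ℝ E] (u : 𝓢'(E, ℂ)) (g : 𝓢(E, ℂ)) :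
    ℂ :=
  u (conjS g)

/-- The pseudodifferential operator `σ^{KN} : 𝓢(ℝ^d) → 𝓢'(ℝ^d)` with Kohn-Nirenberg symbol
`σ ∈ 𝓢'(ℝ^{2d})`. It is given by `⟨σ^{KN} f, g⟩ = ⟨σ, R(g, f)⟩`, see `bracket_kn`. -/
def kn (σ : 𝓢'(Phase d, ℂ)) (f : 𝓢(Space d, ℂ)) : 𝓢'(Space d, ℂ) :=
  ContinuousLinearMap.toPointwiseConvergenceCLM _ _ _ _
    { toFun := fun h => bracket σ (rihaczek (conjS h) f)
      map_add' := fun h₁ h₂ => by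
        simp [bracket, rihaczek]
      map_smul' := fun c h => by
        have : conjS (rihaczek (conjS (c • h)) f) = c • conjS (rihaczek (conjS h) f) := by
          ext z; simp [mul_assoc]
        simp [bracket, this]
      cont := by
        unfold bracket rihaczek
        fun_prop }

/-- The defining identity of the operator `σ^{KN}`. -/
theorem bracket_kn (σ : 𝓢'(Phase d, ℂ)) (f g : 𝓢(Space d, ℂ)) :
    bracket (kn σ f) g = bracket σ (rihaczek g f) := by
  have : conjS (conjS g) = g := by ext; simp
  change bracket σ (rihaczek (conjS (conjS g)) f) = _
  rw [this]

/-- The entries `H_{λμ} = ⟨σ^{KN} π(μ)g, π(λ)g⟩` of the channel matrix. -/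
def channelMatrix (σ : 𝓢'(Phase d, ℂ)) (g : 𝓢(Space d, ℂ)) (l m : Phase d) : ℂ :=
  bracket (kn σ (tfShift m g)) (tfShift l g)

/-- The short-time Fourier transform
`V_g f(x, ξ) = ∫ f(t) \overline{g(t - x)} e^{-2πi ξ·t} dt`. -/
def stft (g f : 𝓢(Space d, ℂ)) (z : Phase d) : ℂ :=
  ∫ t : Space d, f t * conj (g (t - proj₁ z)) *
    Complex.exp (-(2 * Real.pi * Complex.I * (inner ℝ (proj₂ z) t : ℝ)))

/-- The coordinate change `𝒰F(ξ, x) = F(-x, ξ)`. -/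
def rot (F : Phase d → ℂ) (z : Phase d) : ℂ := F (pair (-proj₂ z) (proj₁ z))

/-- The lattice `Λ = aℤ^d × bℤ^d` in `ℝ^{2d}`. -/
def lattice (d : ℕ) (a b : ℝ) : Set (Phase d) :=
  {z | ∃ k l : Fin d → ℤ, (∀ i, z (Sum.inl i) = a * k i) ∧ ∀ i, z (Sum.inr i) = b * l i}

/-- The rectangle
`[-1/(2a) + ε, 1/(2a) - ε]^d × [-1/(2b) + ε, 1/(2b) - ε]^d` in `ℝ^{2d}`. -/
def rect (d : ℕ) (a b ε : ℝ) : Set (Phase d) :=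
  {z | (∀ i, z (Sum.inl i) ∈ Set.Icc (-(1 / (2 * a)) + ε) (1 / (2 * a) - ε)) ∧
    ∀ i, z (Sum.inr i) ∈ Set.Icc (-(1 / (2 * b)) + ε) (1 / (2 * b) - ε)}

end ChannelSampling

end

open ChannelSampling

open Filter Topology

/-! By duality the formula becomes a statement about Schwartz functions. Write `k` for the quotient
`φ / conj (rot (stft g g))`, so that `K = 𝓕⁻ k`. Time-frequency shifts act on the Rihaczek
distribution by translation (`rihaczek_tfShift`), hence `H_λλ = σ(T_λ (conj R(g,g)))`, a sample of a
convolution of `σ`. Pairing `T_λ K` with a test function `ψ` gives `𝓕 G λ`, where `G = k · 𝓕⁻ ψ` is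
supported in `Q` (`integral_mul_translate_fourierInv`). The paired series is therefore `σ` applied
termwise to `(ab)^d ∑ 𝓕 G(λ) T_λ (conj R(g,g))`, and this sum converges in Schwartz space, to
`(ab)^d Ψ`, because `𝓕 G` decays rapidly (`exists_hasSum_smul_translate`).

It remains to see that `σ` takes the same value on `(ab)^d Ψ` and on `ψ`. Since `𝓕 R(g,g) = 𝒰V_g g`
(`fourier_rihaczek`), `𝓕⁻` turns the series into a Fourier series times `conj (𝒰V_g g)`. On `Q` that
Fourier series sums to `G` (`hasSum_fourier_of_support_subset_box`), and on `Q_ε`, where `φ = 1`,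
the product is `𝓕⁻ ψ`. So the inverse transform of `(ab)^d Ψ - ψ` vanishes on `Q_ε`.

Vanishing on the support of a distribution does not in general suffice to be annihilated by it,
since the distribution may see normal derivatives. Here the box can be shrunk into its own interior
by dilations, so the function is a Schwartz limit of functions vanishing near `Q_ε`
(`apply_eq_zero_of_starShaped`). -/

namespace SchwartzMap

/-! ### Summability in Schwartz space. -/

section Convergence

variable {ι E F : Type*} [NormedAddCommGroup E] [NormedSpace ℝ E]
  [NormedAddCommGroup F] [NormedSpace ℝ F]

/-- A family of Schwartz functions all of whose seminorms are summable is summable in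
Schwartz space. -/
theorem exists_hasSum_of_summable_seminorm [CompleteSpace F] {f : ι → 𝓢(E, F)}
    (hf : ∀ k n, Summable fun i => SchwartzMap.seminorm ℝ k n (f i)) :
    ∃ u : 𝓢(E, F), HasSum f u := by
  have hs : ∀ i, ContDiff ℝ (⊤ : ℕ∞) (f i) := fun i => (f i).smooth _
  have hb : ∀ (n : ℕ) (i : ι) (x : E), (n : ℕ∞) ≤ ⊤ →
      ‖iteratedFDeriv ℝ n (f i) x‖ ≤ SchwartzMap.seminorm ℝ 0 n (f i) := fun n i x _ =>
    norm_iteratedFDeriv_le_seminorm ℝ (f i) n x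
  have hsum : ∀ n x, Summable fun i => iteratedFDeriv ℝ n (f i) x := fun n x =>
    .of_norm_bounded (hf 0 n) fun i => hb n i x (mod_cast le_top)
  have hD : ∀ n x, iteratedFDeriv ℝ n (fun y => ∑' i, f i y) x =
      ∑' i, iteratedFDeriv ℝ n (f i) x := fun n x =>
    iteratedFDeriv_tsum_apply hs (fun k _ => hf 0 k) hb (mod_cast le_top) x
  -- An arbitrary index subset lets one estimate serve twice: the full index set gives the decay of
  -- the sum, the complement of a finite set gives the tail.
  have hle : ∀ k n (s : Set ι) x, ‖x‖ ^ k * ‖∑' i : s, iteratedFDeriv ℝ n (f i) x‖ ≤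
      ∑' i : s, SchwartzMap.seminorm ℝ k n (f i) := by
    intro k n s x
    have h1 : Summable fun i : s => ‖iteratedFDeriv ℝ n (f i) x‖ :=
      (Summable.of_nonneg_of_le (fun _ => norm_nonneg _)
        (fun i => hb n i x (mod_cast le_top)) (hf 0 n)).subtype s
    calc ‖x‖ ^ k * ‖∑' i : s, iteratedFDeriv ℝ n (f i) x‖
        ≤ ‖x‖ ^ k * ∑' i : s, ‖iteratedFDeriv ℝ n (f i) x‖ := by
          gcongr; exact norm_tsum_le_tsum_norm h1
      _ = ∑' i : s, ‖x‖ ^ k * ‖iteratedFDeriv ℝ n (f i) x‖ := tsum_mul_left.symm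
      _ ≤ _ := (h1.mul_left _).tsum_le_tsum (fun i => le_seminorm ℝ k n (f i) x)
        ((hf k n).subtype s)
  let u : 𝓢(E, F) :=
    { toFun := fun x => ∑' i, f i x
      smooth' := contDiff_tsum hs (fun k _ => hf 0 k) hb
      decay' := fun k n => ⟨∑' i : (Set.univ : Set ι), SchwartzMap.seminorm ℝ k n (f i), fun x => by
        rw [hD, ← tsum_univ (f := fun i => iteratedFDeriv ℝ n (f i) x)]
        exact hle k n Set.univ x⟩ }
  refine ⟨u, ?_⟩
  rw [HasSum, (schwartz_withSeminorms ℝ E F).tendsto_nhds]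
  rintro ⟨k, n⟩ δ hδ
  have htail := tendsto_tsum_compl_atTop_zero fun i => SchwartzMap.seminorm ℝ k n (f i)
  filter_upwards [htail.eventually (gt_mem_nhds hδ)] with s hs'
  refine lt_of_le_of_lt ?_ hs'
  refine seminorm_le_bound ℝ k n _ (tsum_nonneg fun _ => apply_nonneg _ _) fun x => ?_
  have key : iteratedFDeriv ℝ n (⇑(∑ i ∈ s, f i - u)) x =
      -∑' i : ((s : Set ι)ᶜ : Set ι), iteratedFDeriv ℝ n (f i) x := by
    have h1 : (⇑(∑ i ∈ s, f i - u) : E → F) = (fun y => ∑ i ∈ s, f i y) - fun y => ∑' i, f i y := by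
      ext y; simp [u]; rfl
    have h2 : ContDiff ℝ n fun y => ∑' i, f i y := u.smooth n
    have h3 : ContDiff ℝ n fun y => ∑ i ∈ s, f i y :=
      ContDiff.sum fun i _ => (f i).smooth n
    rw [h1, iteratedFDeriv_sub_apply h3.contDiffAt h2.contDiffAt, hD,
      iteratedFDeriv_fun_sum_apply fun i _ => ((f i).smooth n).contDiffAt,
      ← (hsum n x).sum_add_tsum_compl (s := s)]
    abel
  rw [key, norm_neg]
  exact hle k n _ x

end Convergence

/-! ### Continuity of dilations at factor one. -/

section Dilation

variable {E : Type*} [NormedAddCommGroup E] [NormedSpace ℝ E]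

/-- The dilation `f ↦ f (r • ·)` of a Schwartz function, for `r ≠ 0`. -/
noncomputable def dilate (r : ℝˣ) : 𝓢(E, ℂ) →L[ℂ] 𝓢(E, ℂ) :=
  compCLMOfContinuousLinearEquiv ℂ (ContinuousLinearEquiv.smulLeft r)

@[simp] theorem dilate_apply (r : ℝˣ) (f : 𝓢(E, ℂ)) (x : E) :
    dilate r f x = f ((r : ℝ) • x) := rfl

theorem iteratedFDeriv_dilate (r : ℝˣ) (f : 𝓢(E, ℂ)) (n : ℕ) (x : E) :
    iteratedFDeriv ℝ n (dilate r f) x = (r : ℝ) ^ n • iteratedFDeriv ℝ n f ((r : ℝ) • x) := by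
  have h := iteratedFDeriv_comp_const_smul (i := n) (r : ℝ) (f.smooth n)
  exact congrFun h x

/-- The first term comes from the factor `r ^ n` of the chain rule, the second from the mean value
inequality on the segment from `r • x` to `x`. Since `r ≥ 1/2`, every point of that segment has norm
at least `‖x‖ / 2`; one more power of decay absorbs the length `(1 - r) * ‖x‖`. -/
theorem norm_pow_mul_iteratedFDeriv_dilate_sub_le (f : 𝓢(E, ℂ)) (k n : ℕ) {r : ℝˣ}
    (hr : 1 / 2 ≤ (r : ℝ)) (hr1 : (r : ℝ) ≤ 1) (x : E) :
    ‖x‖ ^ k * ‖iteratedFDeriv ℝ n (⇑(dilate r f - f)) x‖ ≤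
      (1 - (r : ℝ) ^ n) * (2 ^ k * SchwartzMap.seminorm ℝ k n f) +
        (1 - r) * (2 ^ (k + 1) * SchwartzMap.seminorm ℝ (k + 1) (n + 1) f) := by
  have hx : ∀ y ∈ segment ℝ ((r : ℝ) • x) x, ‖x‖ ≤ 2 * ‖y‖ := by
    rintro y ⟨p, q, hp, hq, hpq, rfl⟩
    have h1 : p • (r : ℝ) • x + q • x = (p * r + q) • x := by rw [add_smul, mul_smul]
    have h2 : 1 / 2 ≤ p * r + q := by nlinarith
    rw [h1, norm_smul, Real.norm_eq_abs, abs_of_nonneg (by linarith)]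
    nlinarith [norm_nonneg x]
  have hpow : ∀ (j m : ℕ), ∀ y ∈ segment ℝ ((r : ℝ) • x) x,
      ‖x‖ ^ j * ‖iteratedFDeriv ℝ m f y‖ ≤ 2 ^ j * SchwartzMap.seminorm ℝ j m f := by
    intro j m y hy
    calc ‖x‖ ^ j * ‖iteratedFDeriv ℝ m f y‖
        ≤ (2 * ‖y‖) ^ j * ‖iteratedFDeriv ℝ m f y‖ := by
          gcongr; exact hx y hy
      _ = 2 ^ j * (‖y‖ ^ j * ‖iteratedFDeriv ℝ m f y‖) := by ring
      _ ≤ _ := by gcongr; exact le_seminorm ℝ j m f y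
  have hmv : ‖x‖ ^ k * ‖iteratedFDeriv ℝ n f ((r : ℝ) • x) - iteratedFDeriv ℝ n f x‖ ≤
      (1 - r) * (2 ^ (k + 1) * SchwartzMap.seminorm ℝ (k + 1) (n + 1) f) := by
    rcases eq_or_ne x 0 with rfl | hx0
    · simp only [smul_zero, sub_self, norm_zero, mul_zero]
      exact mul_nonneg (by linarith) (by positivity)
    have hxp : 0 < ‖x‖ := norm_pos_iff.mpr hx0
    have := (convex_segment ((r : ℝ) • x) x).norm_image_sub_le_of_norm_fderiv_le (𝕜 := ℝ)
      (f := iteratedFDeriv ℝ n f)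
      (C := 2 ^ (k + 1) * SchwartzMap.seminorm ℝ (k + 1) (n + 1) f / ‖x‖ ^ (k + 1))
      (fun y _ => ((f.smooth (n + 1 : ℕ)).differentiable_iteratedFDeriv
        (by exact_mod_cast Nat.lt_succ_self n)) y)
      (fun y hy => by
        rw [norm_fderiv_iteratedFDeriv, le_div_iff₀' (by positivity)]
        exact hpow _ _ y hy)
      (right_mem_segment ℝ _ _) (left_mem_segment ℝ _ _)
    have hd : ‖(r : ℝ) • x - x‖ = (1 - r) * ‖x‖ := by
      rw [show (r : ℝ) • x - x = -((1 - (r : ℝ)) • x) by rw [sub_smul, one_smul]; abel, norm_neg,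
        norm_smul, Real.norm_eq_abs, abs_of_nonneg (by linarith)]
    rw [hd] at this
    calc _ ≤ ‖x‖ ^ k * _ := mul_le_mul_of_nonneg_left this (by positivity)
      _ = _ := by field_simp; ring
  have hpr : (r : ℝ) ^ n ≤ 1 := pow_le_one₀ (by linarith) hr1
  have h1 : iteratedFDeriv ℝ n (⇑(dilate r f - f)) x =
      -((1 - (r : ℝ) ^ n) • iteratedFDeriv ℝ n f ((r : ℝ) • x)) +
        (iteratedFDeriv ℝ n f ((r : ℝ) • x) - iteratedFDeriv ℝ n f x) := by
    have : (⇑(dilate r f - f) : E → ℂ) = ⇑(dilate r f) - ⇑f := by ext; simp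
    rw [this, iteratedFDeriv_sub_apply ((dilate r f).smooth n).contDiffAt
      (f.smooth n).contDiffAt, iteratedFDeriv_dilate, sub_smul, one_smul]
    abel
  rw [h1]
  calc _ ≤ ‖x‖ ^ k * (‖-((1 - (r : ℝ) ^ n) • iteratedFDeriv ℝ n f ((r : ℝ) • x))‖ +
        ‖iteratedFDeriv ℝ n f ((r : ℝ) • x) - iteratedFDeriv ℝ n f x‖) := by
        gcongr; exact norm_add_le _ _
    _ = (1 - (r : ℝ) ^ n) * (‖x‖ ^ k * ‖iteratedFDeriv ℝ n f ((r : ℝ) • x)‖) +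
        ‖x‖ ^ k * ‖iteratedFDeriv ℝ n f ((r : ℝ) • x) - iteratedFDeriv ℝ n f x‖ := by
        rw [norm_neg, norm_smul, Real.norm_eq_abs, abs_of_nonneg (by linarith)]; ring
    _ ≤ _ := by
        refine add_le_add (mul_le_mul_of_nonneg_left ?_ (by linarith)) hmv
        exact hpow k n _ (left_mem_segment ℝ _ _)

/-- Dilations by factors increasing to `1` converge to the identity on Schwartz space. -/
theorem tendsto_dilate (f : 𝓢(E, ℂ)) {r : ℕ → ℝˣ} (hr : ∀ m, 1 / 2 ≤ (r m : ℝ))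
    (hr1 : ∀ m, (r m : ℝ) ≤ 1) (hlim : Tendsto (fun m => (r m : ℝ)) atTop (𝓝 1)) :
    Tendsto (fun m => dilate (r m) f) atTop (𝓝 f) := by
  rw [(schwartz_withSeminorms ℝ E ℂ).tendsto_nhds]
  rintro ⟨k, n⟩ δ hδ
  have hl : Tendsto (fun m => (1 - (r m : ℝ) ^ n) * (2 ^ k * SchwartzMap.seminorm ℝ k n f) +
        (1 - (r m : ℝ)) * (2 ^ (k + 1) * SchwartzMap.seminorm ℝ (k + 1) (n + 1) f))
        atTop (𝓝 0) := by
    have := ((hlim.pow n).const_sub 1).mul_const (2 ^ k * SchwartzMap.seminorm ℝ k n f) |>.add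
      ((hlim.const_sub 1).mul_const (2 ^ (k + 1) * SchwartzMap.seminorm ℝ (k + 1) (n + 1) f))
    simpa using this
  filter_upwards [hl.eventually (gt_mem_nhds hδ)] with m hm
  refine lt_of_le_of_lt (seminorm_le_bound ℝ k n _ ?_
    (norm_pow_mul_iteratedFDeriv_dilate_sub_le f k n (hr m) (hr1 m))) hm
  have h1 : (r m : ℝ) ^ n ≤ 1 := pow_le_one₀ (by linarith [hr m]) (hr1 m)
  have h2 := hr1 m
  exact add_nonneg (mul_nonneg (by linarith) (by positivity))
    (mul_nonneg (by linarith) (by positivity))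

end Dilation

/-! ### Approximation by dilated cutoffs. -/

section Cutoff

variable {E : Type*} [NormedAddCommGroup E] [NormedSpace ℝ E]

/-- Pointwise multiplication by a Schwartz function. -/
noncomputable def mulS (f : 𝓢(E, ℂ)) : 𝓢(E, ℂ) →L[ℂ] 𝓢(E, ℂ) := smulLeftCLM ℂ f

@[simp] theorem mulS_apply (f g : 𝓢(E, ℂ)) (x : E) : mulS f g x = f x * g x := by
  simp [mulS, smulLeftCLM_apply_apply f.hasTemperateGrowth]

theorem tsupport_mulS_subset (f g : 𝓢(E, ℂ)) : tsupport (mulS f g) ⊆ tsupport f := by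
  have : (⇑(mulS f g) : E → ℂ) = fun x => f x * g x := by ext; simp
  rw [this]
  exact tsupport_mul_subset_left

/-- Leibniz rule. The bound is uniform in `r` because each derivative of the dilated cutoff gains a
factor `r ≤ 1`. -/
theorem norm_pow_mul_iteratedFDeriv_mulS_dilate_le (χ f : 𝓢(E, ℂ)) (k n : ℕ) {r : ℝˣ}
    (hr0 : 0 ≤ (r : ℝ)) (hr1 : (r : ℝ) ≤ 1) (x : E) :
    ‖x‖ ^ k * ‖iteratedFDeriv ℝ n (mulS (dilate r χ) f) x‖ ≤
      ∑ i ∈ Finset.range (n + 1), (n.choose i : ℝ) *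
        SchwartzMap.seminorm ℝ 0 i χ * SchwartzMap.seminorm ℝ k (n - i) f := by
  have hfun : (⇑(mulS (dilate r χ) f) : E → ℂ) = fun x => dilate r χ x * f x := by ext; simp
  have h := norm_iteratedFDeriv_mul_le (𝕜 := ℝ) (N := n) ((dilate r χ).smooth n) (f.smooth n) x
    (n := n) le_rfl
  rw [hfun]
  refine (mul_le_mul_of_nonneg_left h (by positivity)).trans ?_
  rw [Finset.mul_sum]
  refine Finset.sum_le_sum fun i _ => ?_
  have h1 : ‖iteratedFDeriv ℝ i (dilate r χ) x‖ ≤ SchwartzMap.seminorm ℝ 0 i χ := by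
    rw [iteratedFDeriv_dilate, norm_smul, norm_pow, Real.norm_eq_abs, abs_of_nonneg hr0]
    refine (mul_le_of_le_one_left (norm_nonneg _) (pow_le_one₀ hr0 hr1)).trans ?_
    exact norm_iteratedFDeriv_le_seminorm ℝ χ i _
  calc _ = (n.choose i : ℝ) * ‖iteratedFDeriv ℝ i (dilate r χ) x‖ *
        (‖x‖ ^ k * ‖iteratedFDeriv ℝ (n - i) f x‖) := by ring
    _ ≤ _ := by
      gcongr
      exact le_seminorm ℝ k (n - i) f x

/-- Cutting off a Schwartz function by dilates of a function equal to `1` near the origin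
approximates it in Schwartz space. -/
theorem tendsto_mulS_dilate {χ : 𝓢(E, ℂ)} (hχ : ∀ x, ‖x‖ < 1 → χ x = 1) (f : 𝓢(E, ℂ))
    {r : ℕ → ℝˣ} (hr0 : ∀ m, 0 < (r m : ℝ)) (hr1 : ∀ m, (r m : ℝ) ≤ 1)
    (hlim : Tendsto (fun m => (r m : ℝ)) atTop (𝓝 0)) :
    Tendsto (fun m => mulS (dilate (r m) χ) f) atTop (𝓝 f) := by
  rw [(schwartz_withSeminorms ℝ E ℂ).tendsto_nhds]
  rintro ⟨k, n⟩ δ hδ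
  set C := ∑ i ∈ Finset.range (n + 1), (n.choose i : ℝ) *
        SchwartzMap.seminorm ℝ 0 i χ * SchwartzMap.seminorm ℝ (k + 1) (n - i) f +
        SchwartzMap.seminorm ℝ (k + 1) n f with hC
  have hC0 : 0 ≤ C := by positivity
  have hl : Tendsto (fun m => (r m : ℝ) * C) atTop (𝓝 0) := by simpa using hlim.mul_const C
  filter_upwards [hl.eventually (gt_mem_nhds hδ)] with m hm
  refine lt_of_le_of_lt (seminorm_le_bound ℝ k n _ (mul_nonneg (hr0 m).le hC0) fun x => ?_) hm
  have hfun : (⇑(mulS (dilate (r m) χ) f - f) : E → ℂ) = ⇑(mulS (dilate (r m) χ) f) - ⇑f := by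
    ext; simp
  -- The difference vanishes identically where the cutoff is `1`. Elsewhere `1 ≤ r m * ‖x‖`, which
  -- trades one power of `‖x‖` for the small factor `r m`.
  by_cases hx : ‖(r m : ℝ) • x‖ < 1
  · have hev : (⇑(mulS (dilate (r m) χ) f - f) : E → ℂ) =ᶠ[𝓝 x] fun _ => 0 := by
      have : {y : E | ‖(r m : ℝ) • y‖ < 1} ∈ 𝓝 x :=
        (isOpen_lt (by fun_prop) continuous_const).mem_nhds hx
      filter_upwards [this] with y hy
      simp [hχ _ hy]
    rw [(hev.iteratedFDeriv ℝ n).eq_of_nhds]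
    rw [iteratedFDeriv_fun_zero, Pi.zero_apply, norm_zero, mul_zero]
    exact mul_nonneg (hr0 m).le hC0
  · rw [not_lt, norm_smul, Real.norm_eq_abs, abs_of_pos (hr0 m)] at hx
    have h1 : ‖x‖ ^ (k + 1) * ‖iteratedFDeriv ℝ n (⇑(mulS (dilate (r m) χ) f - f)) x‖ ≤ C := by
      rw [hfun, iteratedFDeriv_sub_apply ((mulS (dilate (r m) χ) f).smooth n).contDiffAt
        (f.smooth n).contDiffAt]
      refine (mul_le_mul_of_nonneg_left (norm_sub_le _ _) (by positivity)).trans ?_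
      rw [mul_add]
      exact add_le_add (norm_pow_mul_iteratedFDeriv_mulS_dilate_le χ f _ n (hr0 m).le (hr1 m) x)
        (le_seminorm ℝ _ n f x)
    set A := ‖iteratedFDeriv ℝ n (⇑(mulS (dilate (r m) χ) f - f)) x‖
    calc ‖x‖ ^ k * A ≤ (r m * ‖x‖) * (‖x‖ ^ k * A) :=
          le_mul_of_one_le_left (by positivity) hx
      _ = r m * (‖x‖ ^ (k + 1) * A) := by ring
      _ ≤ _ := mul_le_mul_of_nonneg_left h1 (hr0 m).le

end Cutoff

end SchwartzMap

/-! ### Distributional support and vanishing criteria. -/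

namespace TemperedDistribution

variable {E : Type*} [NormedAddCommGroup E] [NormedSpace ℝ E] [FiniteDimensional ℝ E]

theorem hasSum_apply {κ E : Type*} [NormedAddCommGroup E] [NormedSpace ℝ E] (T : 𝓢'(E, ℂ))
    {f : κ → 𝓢(E, ℂ)} {u : 𝓢(E, ℂ)} (h : HasSum f u) : HasSum (fun i => T (f i)) (T u) :=
  h.map T T.continuous

/-- Around each point there is a Schwartz bump function, equal to `1` near the point and supported
in a given neighbourhood. -/
theorem exists_schwartz_bump {x : E} {s : Set E} (hs : s ∈ 𝓝 x) :
    ∃ χ : 𝓢(E, ℂ), tsupport χ ⊆ s ∧ ∀ᶠ y in 𝓝 x, χ y = 1 := by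
  obtain ⟨δ, hδ, hδs⟩ := Metric.nhds_basis_closedBall.mem_iff.mp hs
  let β : ContDiffBump x := ⟨δ / 2, δ, by positivity, by linarith⟩
  have h1 : tsupport (Complex.ofRealCLM ∘ β) ⊆ Metric.closedBall x δ :=
    (tsupport_comp_subset rfl _).trans β.tsupport_eq.subset
  have h2 : HasCompactSupport (Complex.ofRealCLM ∘ β) := β.hasCompactSupport.comp_left rfl
  refine ⟨h2.toSchwartzMap (Complex.ofRealCLM.contDiff.comp β.contDiff), h1.trans hδs, ?_⟩
  filter_upwards [β.eventuallyEq_one] with y hy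
  simp [hy]

/-- A tempered distribution vanishes on Schwartz functions whose support is disjoint from the
distributional support. -/
theorem apply_eq_zero_of_disjoint_dsupport (T : 𝓢'(E, ℂ)) (v : 𝓢(E, ℂ))
    (hv : Disjoint (tsupport v) (Distribution.dsupport T)) : T v = 0 := by
  have hcomp : ∀ w : 𝓢(E, ℂ), HasCompactSupport w →
      Disjoint (tsupport w) (Distribution.dsupport T) → T w = 0 := by
    intro w hwc hw
    -- Compactness induction patches the local vanishing together: a single multiplier is `1` on the
    -- support of `w` and sends every test function into the kernel of `T`.
    have key : ∃ χ : 𝓢(E, ℂ), (∀ x ∈ tsupport w, χ x = 1) ∧ ∀ u, T (mulS χ u) = 0 := by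
      refine hwc.isCompact.induction_on (p := fun s => ∃ χ : 𝓢(E, ℂ), (∀ x ∈ s, χ x = 1) ∧
        ∀ u, T (mulS χ u) = 0) ⟨0, by simp, fun u => ?_⟩ ?_ ?_ ?_
      · have : mulS 0 u = 0 := by ext; simp
        rw [this, map_zero]
      · rintro s t hst ⟨χ, h1, h2⟩
        exact ⟨χ, fun x hx => h1 x (hst hx), h2⟩
      · rintro s t ⟨χ, h1, h2⟩ ⟨η, h3, h4⟩
        -- This is `1 - (1 - χ)(1 - η)`, equal to `1` wherever `χ` or `η` is.
        refine ⟨χ + η - mulS χ η, ?_, fun u => ?_⟩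
        · rintro x (hx | hx)
          · simp [h1 x hx]
          · simp [h3 x hx]
        · have : mulS (χ + η - mulS χ η) u = mulS χ u + mulS η u - mulS χ (mulS η u) := by
            ext; simp; ring
          rw [this, map_sub, map_add, h2, h4, h2]; simp
      · intro x hx
        have hx' : x ∉ Distribution.dsupport T := Set.disjoint_left.mp hw hx
        obtain ⟨s, hs, hso, hxs⟩ := (Distribution.notMem_dsupport_iff x).mp hx'
        obtain ⟨χ, h1, h2⟩ := exists_schwartz_bump (hso.mem_nhds hxs)
        exact ⟨{y | χ y = 1}, mem_nhdsWithin_of_mem_nhds h2, χ, fun y hy => hy,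
          fun u => hs _ ((SchwartzMap.tsupport_mulS_subset χ u).trans h1)⟩
    obtain ⟨χ, h1, h2⟩ := key
    have : mulS χ w = w := by
      ext x
      by_cases hx : x ∈ tsupport w
      · simp [h1 x hx]
      · simp [image_eq_zero_of_notMem_tsupport hx]
    rw [← this, h2]
  -- The general case follows by cutting `v` off with dilated bumps, which does not enlarge its
  -- support.
  let β : ContDiffBump (0 : E) := ⟨1, 2, one_pos, one_lt_two⟩
  have hβc : HasCompactSupport (Complex.ofRealCLM ∘ β) := β.hasCompactSupport.comp_left rfl
  let χ : 𝓢(E, ℂ) := hβc.toSchwartzMap (Complex.ofRealCLM.contDiff.comp β.contDiff)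
  have hχ : ∀ x, ‖x‖ < 1 → χ x = 1 := fun x hx => by
    have : β x = 1 := β.one_of_mem_closedBall (by simpa [β] using hx.le)
    simp [χ, this]
  let r : ℕ → ℝˣ := fun m => Units.mk0 (1 / ((m : ℝ) + 1)) (by positivity)
  have hlim := tendsto_mulS_dilate hχ v (r := r)
    (fun m => by simp only [r, Units.val_mk0]; positivity)
    (fun m => by
      simp only [r, Units.val_mk0]
      rw [div_le_one (by positivity)]; linarith [(Nat.cast_nonneg m : (0 : ℝ) ≤ m)])
    tendsto_one_div_add_atTop_nhds_zero_nat
  have hlim' : Tendsto (fun m => T (mulS (dilate (r m) χ) v)) atTop (𝓝 (T v)) :=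
    (T.continuous.tendsto v).comp hlim
  refine tendsto_nhds_unique hlim' (tendsto_const_nhds.congr fun m => (hcomp _ ?_ ?_).symm)
  · have h1 : HasCompactSupport (dilate (r m) χ) :=
      hβc.comp_homeomorph (Homeomorph.smulOfNeZero (r m : ℝ) (r m).ne_zero)
    have h2 : (⇑(mulS (dilate (r m) χ) v) : E → ℂ) = fun x => dilate (r m) χ x * v x := by
      ext; simp
    rw [h2]
    exact h1.mul_right
  · refine hv.mono_left ?_
    have h2 : (⇑(mulS (dilate (r m) χ) v) : E → ℂ) = fun x => dilate (r m) χ x * v x := by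
      ext; simp
    rw [h2]
    exact tsupport_mul_subset_right

/-- If the support of a tempered distribution lies in a set whose dilates by factors larger than
`1` are neighbourhoods of it, then the distribution vanishes on Schwartz functions vanishing on the
set. -/
theorem apply_eq_zero_of_starShaped (T : 𝓢'(E, ℂ)) {S : Set E}
    (hT : Distribution.dsupport T ⊆ S)
    (hS : ∀ r : ℝ, 1 / 2 ≤ r → r < 1 → ∀ z ∈ S, ∀ᶠ y in 𝓝 z, r • y ∈ S)
    (v : 𝓢(E, ℂ)) (hv : ∀ z ∈ S, v z = 0) : T v = 0 := by
  -- The factors are `1 - 1/(m + 2)`; the shift by two keeps them at least `1/2`.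
  let r : ℕ → ℝˣ := fun m => Units.mk0 (1 - 1 / ((m : ℝ) + 1 + 1)) (by
    have : 1 / ((m : ℝ) + 1 + 1) < 1 := by
      rw [div_lt_one (by positivity)]; linarith [(Nat.cast_nonneg m : (0 : ℝ) ≤ m)]
    linarith)
  have hr : ∀ m, 1 / 2 ≤ (r m : ℝ) := fun m => by
    have : 1 / ((m : ℝ) + 1 + 1) ≤ 1 / 2 := by
      gcongr
      linarith [(Nat.cast_nonneg m : (0 : ℝ) ≤ m)]
    simp only [r, Units.val_mk0]; linarith
  have hr1 : ∀ m, (r m : ℝ) < 1 := fun m => by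
    have : 0 < 1 / ((m : ℝ) + 1 + 1) := by positivity
    simp only [r, Units.val_mk0]; linarith
  have hlim : Tendsto (fun m => (r m : ℝ)) atTop (𝓝 1) := by
    have := (tendsto_one_div_add_atTop_nhds_zero_nat (𝕜 := ℝ)).comp (tendsto_add_atTop_nat 1)
    have := this.const_sub 1
    simpa [r, Function.comp_def] using this
  have hlim' : Tendsto (fun m => T (dilate (r m) v)) atTop (𝓝 (T v)) :=
    (T.continuous.tendsto v).comp (tendsto_dilate v hr (fun m => (hr1 m).le) hlim)
  refine tendsto_nhds_unique hlim' (tendsto_const_nhds.congr fun m => ?_)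
  -- Points near `S` are moved into `S` by a factor `r < 1`, so the dilate of `v` vanishes on a
  -- neighbourhood of the support.
  refine (apply_eq_zero_of_disjoint_dsupport T _ ?_).symm
  refine Set.disjoint_left.mpr fun z hz hzT => ?_
  refine (notMem_tsupport_iff_eventuallyEq.mpr ?_) hz
  filter_upwards [hS (r m) (hr m) (hr1 m) z (hT hzT)] with y hy
  simp [hv _ hy]

end TemperedDistribution

/-! ### Fourier series of functions supported in a cube. -/

section FourierSeries

/-- A function continuous on `ℝ^ι` and supported in a centred cube vanishes on the
boundary of the cube. -/
theorem abs_lt_of_ne_zero_of_continuous {ι : Type*} {h : (ι → ℝ) → ℂ} (hc : Continuous h)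
    {δ : ℝ} (hδ : 0 < δ)
    (hs : ∀ x, h x ≠ 0 → ∀ i, |x i| ≤ δ) {x : ι → ℝ} (hx : h x ≠ 0) (i : ι) : |x i| < δ := by
  refine lt_of_le_of_ne (hs x hx i) fun hi => hx ?_
  -- Moving outward along the ray through a boundary point leaves the cube, where `h` is zero;
  -- continuity does the rest.
  have h1 : Tendsto (fun t : ℝ => h ((1 + t) • x)) (𝓝[>] 0) (𝓝 (h x)) := by
    have : Continuous fun t : ℝ => h ((1 + t) • x) := by fun_prop
    simpa using (this.tendsto 0).mono_left nhdsWithin_le_nhds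
  refine tendsto_nhds_unique h1 (tendsto_const_nhds.congr' ?_)
  filter_upwards [self_mem_nhdsWithin] with t ht
  by_contra hne
  have h2 := hs _ (Ne.symm hne) i
  have ht' : (0 : ℝ) < t := ht
  rw [Pi.smul_apply, smul_eq_mul, abs_mul, hi, abs_of_pos (by linarith)] at h2
  nlinarith

variable {ι : Type*} [Fintype ι]

theorem UnitAddTorus.mFourier_coe_apply (n : ι → ℤ) (x : ι → ℝ) :
    UnitAddTorus.mFourier n (fun i => (x i : UnitAddCircle)) =
      Complex.exp (2 * Real.pi * Complex.I * (∑ i, n i * x i : ℝ)) := by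
  simp only [UnitAddTorus.mFourier, ContinuousMap.coe_mk, fourier_coe_apply]
  rw [← Complex.exp_sum]
  congr 1
  push_cast
  rw [Finset.mul_sum]
  refine Finset.sum_congr rfl fun i _ => ?_
  simp; ring

theorem locallyFinite_support_comp_add {h : (ι → ℝ) → ℂ} {δ : ℝ}
    (hs : ∀ x, h x ≠ 0 → ∀ i, |x i| ≤ δ) :
    LocallyFinite fun (n : ι → ℤ) => Function.support fun x : ι → ℝ => h fun i => x i + n i := by
  classical
  intro x
  refine ⟨Metric.ball x 1, Metric.ball_mem_nhds x one_pos, ?_⟩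
  refine (Set.finite_Icc (fun i => ⌊-x i - δ - 1⌋) (fun i => ⌈-x i + δ + 1⌉)).subset ?_
  rintro n ⟨y, hy, hyx⟩
  have h1 := hs _ hy
  have h2 : ∀ i, |y i - x i| < 1 := fun i => by
    have := (dist_le_pi_dist y x i).trans_lt hyx
    rwa [Real.dist_eq] at this
  refine ⟨fun i => ?_, fun i => ?_⟩
  · have a1 := abs_le.mp (h1 i)
    have a2 := abs_lt.mp (h2 i)
    have : ((⌊-x i - δ - 1⌋ : ℤ) : ℝ) ≤ n i := (Int.floor_le _).trans (by linarith)
    exact_mod_cast this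
  · have a1 := abs_le.mp (h1 i)
    have a2 := abs_lt.mp (h2 i)
    have : (n i : ℝ) ≤ ((⌈-x i + δ + 1⌉ : ℤ) : ℝ) := le_trans (by linarith) (Int.le_ceil _)
    exact_mod_cast this

/-- Fourier series expansion of a function supported in the unit cube. -/
theorem hasSum_fourier_of_support_subset_cube {h : (ι → ℝ) → ℂ} (hc : Continuous h)
    (hs : ∀ x, h x ≠ 0 → ∀ i, |x i| ≤ 1 / 2)
    (hsum : Summable fun n : ι → ℤ =>
      ∫ x : ι → ℝ, Complex.exp (-(2 * Real.pi * Complex.I * (∑ i, n i * x i : ℝ))) * h x)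
    {x : ι → ℝ} (hx : ∀ i, |x i| ≤ 1 / 2) :
    HasSum (fun n : ι → ℤ =>
      (∫ y : ι → ℝ, Complex.exp (-(2 * Real.pi * Complex.I * (∑ i, n i * y i : ℝ))) * h y) *
        Complex.exp (2 * Real.pi * Complex.I * (∑ i, n i * x i : ℝ))) (h x) := by
  classical
  have hs' : ∀ x, h x ≠ 0 → ∀ i, |x i| < 1 / 2 := fun x hx i =>
    -- The strict inequality keeps neighbouring translates from meeting `h` on the boundary, so the
    -- periodization `P` agrees with `h` on the closed cube.
    abs_lt_of_ne_zero_of_continuous hc (by norm_num) hs hx i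
  let P : (ι → ℝ) → ℂ := fun x => ∑ᶠ n : ι → ℤ, h fun i => x i + n i
  have hPc : Continuous P := continuous_finsum (fun n => by fun_prop)
    (locallyFinite_support_comp_add hs)
  have hPp : ∀ x (m : ι → ℤ), P (fun i => x i + m i) = P x := by
    intro x m
    refine (finsum_eq_of_bijective (fun n => m + n) (Equiv.addLeft m).bijective fun n => ?_)
    congr 1; ext i; simp; ring
  have hPh : ∀ x : ι → ℝ, (∀ i, |x i| ≤ 1 / 2) → P x = h x := by
    intro x hx
    have : P x = h fun i => x i + (0 : ι → ℤ) i := finsum_eq_single _ 0 fun n hn => by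
      by_contra hne
      obtain ⟨i, hi⟩ := Function.ne_iff.mp hn
      have h1 := abs_lt.mp (hs' _ hne i)
      have h2 := abs_le.mp (hx i)
      have h3 : (-1 : ℝ) < n i := by linarith
      have h4 : (n i : ℝ) < 1 := by linarith
      have h5 : (-1 : ℤ) < n i := by exact_mod_cast h3
      have h6 : n i < (1 : ℤ) := by exact_mod_cast h4
      exact hi (by simp only [Pi.zero_apply]; omega)
    simpa using this
  let π : (ι → ℝ) → UnitAddTorus ι := fun x i => (x i : UnitAddCircle)
  have hπ : IsOpenQuotientMap π :=
    IsOpenQuotientMap.piMap fun _ => QuotientAddGroup.isOpenQuotientMap_mk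
  -- `P` descends to the torus: representatives of a point differ by integer vectors, so its
  -- periodicity makes the chosen section irrelevant.
  let f : UnitAddTorus ι → ℂ := fun y => P (Function.surjInv hπ.surjective y)
  have hfP : ∀ x, f (π x) = P x := by
    intro x
    have h1 := Function.surjInv_eq hπ.surjective (π x)
    have h2 : ∀ i, ∃ k : ℤ, Function.surjInv hπ.surjective (π x) i = x i + k := by
      intro i
      have h3 : ((Function.surjInv hπ.surjective (π x) i : ℝ) : UnitAddCircle) = (x i : ℝ) :=
        congrFun h1 i
      rw [← sub_eq_zero, ← AddCircle.coe_sub, AddCircle.coe_eq_zero_iff] at h3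
      obtain ⟨k, hk⟩ := h3
      exact ⟨k, by rw [zsmul_one] at hk; linarith⟩
    choose k hk using h2
    have : Function.surjInv hπ.surjective (π x) = fun i => x i + k i := funext hk
    change P (Function.surjInv hπ.surjective (π x)) = P x
    rw [this, hPp]
  have hfc : Continuous f := by
    rw [hπ.isQuotientMap.continuous_iff]
    exact hPc.congr fun x => (hfP x).symm
  have hcoef : ∀ n : ι → ℤ, UnitAddTorus.mFourierCoeff f n =
      ∫ x : ι → ℝ, Complex.exp (-(2 * Real.pi * Complex.I * (∑ i, n i * x i : ℝ))) * h x := by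
    intro n
    rw [UnitAddTorus.mFourierCoeff_eq_integral f n (fun _ => -(1 / 2))]
    have hmeas : MeasurableSet
        {x : ι → ℝ | ∀ i, x i ∈ Set.Ioc (-(1 / 2) : ℝ) (-(1 / 2) + 1)} :=
      MeasurableSet.univ_pi' fun i => measurableSet_Ioc
    refine Eq.trans ?_ (setIntegral_eq_integral_of_forall_compl_eq_zero
      (s := {x : ι → ℝ | ∀ i, x i ∈ Set.Ioc (-(1 / 2) : ℝ) (-(1 / 2) + 1)}) ?_)
    · refine setIntegral_congr_fun hmeas fun x hx => ?_
      have h1 : f (π x) = h x := by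
        rw [hfP, hPh x fun i => abs_le.mpr ⟨(hx i).1.le, by linarith [(hx i).2]⟩]
      change UnitAddTorus.mFourier (-n) (fun i => (x i : UnitAddCircle)) • f (π x) = _
      rw [h1, UnitAddTorus.mFourier_coe_apply, smul_eq_mul]
      congr 2
      simp
    · intro x hx
      by_contra hne
      have h1 := hs' x (right_ne_zero_of_mul hne)
      refine hx fun i => ?_
      have := abs_lt.mp (h1 i)
      exact ⟨this.1, by linarith⟩
  have := UnitAddTorus.hasSum_mFourier_series_apply_of_summable (f := ⟨f, hfc⟩)
    (by simpa only [ContinuousMap.coe_mk, hcoef] using hsum.congr fun n => (hcoef n).symm) (π x)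
  simp only [ContinuousMap.coe_mk, hfP, hPh x hx, hcoef, smul_eq_mul] at this
  refine this.congr_fun fun n => ?_
  rw [UnitAddTorus.mFourier_coe_apply]

end FourierSeries

/-! ### Fourier integrals with explicit exponentials. -/

section FourierIntegral

variable {V : Type*} [NormedAddCommGroup V] [InnerProductSpace ℝ V] [FiniteDimensional ℝ V]
  [MeasurableSpace V] [BorelSpace V]

theorem Real.fourier_apply_eq_integral_cexp (f : V → ℂ) (w : V) :
    𝓕 f w = ∫ v, Complex.exp (-(2 * Real.pi * Complex.I * (inner ℝ v w : ℝ))) * f v := by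
  rw [Real.fourier_eq]
  refine integral_congr_ae (ae_of_all _ fun v => ?_)
  simp only [Circle.smul_def, Real.fourierChar_apply, smul_eq_mul]
  congr 2
  push_cast
  ring

theorem Real.fourierInv_apply_eq_integral_cexp (f : V → ℂ) (w : V) :
    𝓕⁻ f w = ∫ v, Complex.exp (2 * Real.pi * Complex.I * (inner ℝ v w : ℝ)) * f v := by
  rw [Real.fourierInv_eq_fourier_neg, Real.fourier_apply_eq_integral_cexp]
  simp

theorem SchwartzMap.fourier_apply_eq_integral_cexp (f : 𝓢(V, ℂ)) (w : V) :
    𝓕 f w = ∫ v, Complex.exp (-(2 * Real.pi * Complex.I * (inner ℝ v w : ℝ))) * f v := by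
  rw [fourier_coe, Real.fourier_apply_eq_integral_cexp]

theorem SchwartzMap.fourierInv_apply_eq_integral_cexp (f : 𝓢(V, ℂ)) (w : V) :
    𝓕⁻ f w = ∫ v, Complex.exp (2 * Real.pi * Complex.I * (inner ℝ v w : ℝ)) * f v := by
  rw [fourierInv_coe, Real.fourierInv_apply_eq_integral_cexp]

theorem SchwartzMap.fourierInv_apply_eq_fourier_neg (f : 𝓢(V, ℂ)) (w : V) :
    𝓕⁻ f w = 𝓕 f (-w) := by
  rw [fourierInv_coe, fourier_coe, Real.fourierInv_eq_fourier_neg]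

end FourierIntegral

namespace ChannelSampling

/-! ### Fourier transform, translation and conjugation. -/

section FourierShift

variable {V : Type*} [NormedAddCommGroup V] [InnerProductSpace ℝ V] [FiniteDimensional ℝ V]
  [MeasurableSpace V] [BorelSpace V]

theorem fourier_translate (x : V) (f : 𝓢(V, ℂ)) (w : V) :
    𝓕 (translate x f) w =
      Complex.exp (-(2 * Real.pi * Complex.I * (inner ℝ x w : ℝ))) * 𝓕 f w := by
  rw [SchwartzMap.fourier_apply_eq_integral_cexp, SchwartzMap.fourier_apply_eq_integral_cexp,
    ← integral_const_mul, ← integral_add_right_eq_self _ x]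
  refine integral_congr_ae (ae_of_all _ fun v => ?_)
  simp only [translate_apply, add_sub_cancel_right, inner_add_left]
  rw [← mul_assoc, ← Complex.exp_add]
  congr 2
  push_cast
  ring

theorem fourierInv_translate (x : V) (f : 𝓢(V, ℂ)) (w : V) :
    𝓕⁻ (translate x f) w =
      Complex.exp (2 * Real.pi * Complex.I * (inner ℝ x w : ℝ)) * 𝓕⁻ f w := by
  rw [SchwartzMap.fourierInv_apply_eq_fourier_neg, fourier_translate,
    SchwartzMap.fourierInv_apply_eq_fourier_neg]
  simp

theorem fourierInv_conjS (f : 𝓢(V, ℂ)) (w : V) : 𝓕⁻ (conjS f) w = conj (𝓕 f w) := by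
  rw [SchwartzMap.fourierInv_apply_eq_integral_cexp, SchwartzMap.fourier_apply_eq_integral_cexp,
    ← integral_conj]
  refine integral_congr_ae (ae_of_all _ fun v => ?_)
  simp only [conjS_apply, map_mul, ← Complex.exp_conj, map_neg, Complex.conj_I, Complex.conj_ofReal,
    map_ofNat]
  congr 2
  ring

/-- Pairing with a translate of `𝓕⁻ k` samples the Fourier transform of `k * 𝓕⁻ ψ`. -/
theorem integral_mul_translate_fourierInv (k ψ : 𝓢(V, ℂ)) (x : V) :
    ∫ z, ψ z * translate x (𝓕⁻ k) z = 𝓕 (mulS k (𝓕⁻ ψ)) x := by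
  have h := SchwartzMap.integral_fourier_mul_eq (𝓕⁻ ψ) (translate x (𝓕⁻ k))
  rw [FourierTransform.fourier_fourierInv_eq] at h
  rw [h, SchwartzMap.fourier_apply_eq_integral_cexp]
  refine integral_congr_ae (ae_of_all _ fun v => ?_)
  simp only [fourier_translate, FourierTransform.fourier_fourierInv_eq, mulS_apply]
  rw [real_inner_comm]
  ring

end FourierShift

/-! ### Sampling Schwartz functions on a lattice. -/

section LatticeSampling

variable {ι : Type*} [Fintype ι]

/-- The point `(sᵢ nᵢ)ᵢ` of the lattice `∏ᵢ sᵢ ℤ`. -/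
noncomputable def latticePoint (s : ι → ℝ) (n : ι → ℤ) : EuclideanSpace ℝ ι :=
  WithLp.toLp 2 fun i => s i * n i

@[simp] theorem latticePoint_apply {ι : Type*} (s : ι → ℝ) (n : ι → ℤ) (i : ι) :
    latticePoint s n i = s i * n i := rfl

theorem latticePoint_injective {ι : Type*} {s : ι → ℝ} (hs : ∀ i, 0 < s i) :
    Function.Injective (latticePoint s) := by
  intro n m h
  ext i
  have h1 : s i * (n i : ℝ) = s i * m i := by
    rw [← latticePoint_apply, h, latticePoint_apply]
  exact_mod_cast mul_left_cancel₀ (hs i).ne' h1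

theorem inner_latticePoint (s : ι → ℝ) (n : ι → ℤ) (z : EuclideanSpace ℝ ι) :
    (inner ℝ (latticePoint s n) z : ℝ) = ∑ i, n i * (s i * z i) := by
  rw [PiLp.inner_apply]
  refine Finset.sum_congr rfl fun i _ => ?_
  simp; ring

theorem exists_summable_norm_latticePoint {s : ι → ℝ} (hs : ∀ i, 0 < s i) :
    ∃ N : ℕ, Summable fun n : ι → ℤ => ((1 + ‖latticePoint s n‖) ^ N)⁻¹ := by
  classical
  let b := ((EuclideanSpace.basisFun ι ℝ).toBasis).unitsSMul fun i => Units.mk0 (s i) (hs i).ne'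
  let L := Submodule.span ℤ (Set.range b)
  have hmem : ∀ n : ι → ℤ, latticePoint s n ∈ L := by
    intro n
    have : latticePoint s n = ∑ i, n i • b i := by
      ext j
      simp [b, Module.Basis.unitsSMul_apply, Units.smul_def, Finset.sum_apply, Pi.single_apply,
        mul_comm]
    rw [this]
    exact Submodule.sum_mem _ fun i _ =>
      Submodule.smul_mem _ _ (Submodule.subset_span (Set.mem_range_self i))
  let e : (ι → ℤ) → L := fun n => ⟨latticePoint s n, hmem n⟩
  have he : Function.Injective e := fun n m h =>
    latticePoint_injective hs (congrArg Subtype.val h)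
  have h1 := (ZLattice.summable_norm_pow_inv L _ (Nat.lt_succ_self _)).comp_injective he
  refine ⟨Module.finrank ℤ L + 1, Summable.of_norm_bounded_eventually h1 ?_⟩
  -- The comparison with `‖latticePoint s n‖⁻¹` fails only at the origin, where that inverse is `0`
  -- by convention.
  refine (Set.finite_singleton (0 : ι → ℤ)).subset fun n hn => ?_
  by_contra hn0
  refine hn ?_
  have hpos : 0 < ‖latticePoint s n‖ := by
    refine norm_pos_iff.mpr fun h => hn0 (latticePoint_injective hs ?_)
    rw [h]; ext i; simp
  change ‖((1 + ‖latticePoint s n‖) ^ _)⁻¹‖ ≤ ‖latticePoint s n‖⁻¹ ^ _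
  rw [Real.norm_eq_abs, abs_of_nonneg (by positivity), inv_pow]
  gcongr
  linarith

/-- A Schwartz function sampled on a lattice is summable against polynomial weights. -/
theorem summable_pow_mul_norm_latticePoint {s : ι → ℝ} (hs : ∀ i, 0 < s i)
    (u : 𝓢(EuclideanSpace ℝ ι, ℂ)) (k : ℕ) :
    Summable fun n : ι → ℤ => (1 + ‖latticePoint s n‖) ^ k * ‖u (latticePoint s n)‖ := by
  obtain ⟨N, hN⟩ := exists_summable_norm_latticePoint hs
  refine Summable.of_nonneg_of_le (fun n => by positivity) (fun n => ?_) (hN.mul_left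
    (2 ^ (k + N) * (Finset.Iic (k + N, 0)).sup (fun m => SchwartzMap.seminorm ℝ m.1 m.2) u))
  have h := SchwartzMap.one_add_le_sup_seminorm_apply (𝕜 := ℝ) (m := (k + N, 0)) (k := k + N)
    (n := 0) le_rfl le_rfl u (latticePoint s n)
  rw [norm_iteratedFDeriv_zero] at h
  rw [← div_eq_mul_inv, le_div_iff₀ (by positivity)]
  calc _ = (1 + ‖latticePoint s n‖) ^ (k + N) * ‖u (latticePoint s n)‖ := by ring
    _ ≤ _ := h

end LatticeSampling

/-! ### Growth of Schwartz seminorms under translation. -/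

section TranslateSeminorm

variable {E : Type*} [NormedAddCommGroup E] [NormedSpace ℝ E]

theorem seminorm_real_smul (k n : ℕ) (c : ℂ) (f : 𝓢(E, ℂ)) :
    SchwartzMap.seminorm ℝ k n (c • f) = ‖c‖ * SchwartzMap.seminorm ℝ k n f :=
  map_smul_eq_mul (SchwartzMap.seminorm ℂ k n) c f

/-- The growth in `x` is polynomial because `‖y‖ ≤ (1 + ‖x‖) * (1 + ‖y - x‖)`; rapidly decaying
coefficients therefore beat it. -/
theorem seminorm_translate_le (f : 𝓢(E, ℂ)) (k n : ℕ) (x : E) :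
    SchwartzMap.seminorm ℝ k n (translate x f) ≤ (1 + ‖x‖) ^ k *
      (2 ^ k * (Finset.Iic (k, n)).sup (fun m => SchwartzMap.seminorm ℝ m.1 m.2) f) := by
  refine seminorm_le_bound ℝ k n _ (by positivity) fun y => ?_
  have h1 : iteratedFDeriv ℝ n (translate x f) y = iteratedFDeriv ℝ n f (y - x) :=
    iteratedFDeriv_comp_sub n x y
  have h2 : ‖y‖ ≤ (1 + ‖x‖) * (1 + ‖y - x‖) := by
    have := norm_add_le (y - x) x
    rw [sub_add_cancel] at this
    nlinarith [norm_nonneg x, norm_nonneg (y - x), mul_nonneg (norm_nonneg x) (norm_nonneg (y - x))]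
  rw [h1]
  calc ‖y‖ ^ k * ‖iteratedFDeriv ℝ n f (y - x)‖
      ≤ ((1 + ‖x‖) * (1 + ‖y - x‖)) ^ k * ‖iteratedFDeriv ℝ n f (y - x)‖ := by gcongr
    _ = (1 + ‖x‖) ^ k * ((1 + ‖y - x‖) ^ k * ‖iteratedFDeriv ℝ n f (y - x)‖) := by
      rw [mul_pow, mul_assoc]
    _ ≤ _ := mul_le_mul_of_nonneg_left
      (SchwartzMap.one_add_le_sup_seminorm_apply (𝕜 := ℝ) (m := (k, n)) le_rfl le_rfl f _)
      (by positivity)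

end TranslateSeminorm

/-! ### Series of lattice translates and the sampling expansion. -/

section Series

variable {ι : Type*} [Fintype ι]

/-- A series of lattice translates of a Schwartz function, with coefficients sampled from a
Schwartz function, converges in Schwartz space. -/
theorem exists_hasSum_smul_translate {s : ι → ℝ} (hs : ∀ i, 0 < s i)
    (u f : 𝓢(EuclideanSpace ℝ ι, ℂ)) :
    ∃ Ψ : 𝓢(EuclideanSpace ℝ ι, ℂ), HasSum
      (fun n : ι → ℤ => u (latticePoint s n) • translate (latticePoint s n) f) Ψ := by
  refine SchwartzMap.exists_hasSum_of_summable_seminorm fun k m => ?_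
  set C := 2 ^ k * (Finset.Iic (k, m)).sup (fun m => SchwartzMap.seminorm ℝ m.1 m.2) f
  refine Summable.of_nonneg_of_le (fun n => apply_nonneg _ _) (fun n => ?_)
    ((summable_pow_mul_norm_latticePoint hs u k).mul_right C)
  have h1 : SchwartzMap.seminorm ℝ k m
      (u (latticePoint s n) • translate (latticePoint s n) f) =
      ‖u (latticePoint s n)‖ * SchwartzMap.seminorm ℝ k m (translate (latticePoint s n) f) :=
    seminorm_real_smul k m _ _
  rw [h1]
  calc _ ≤ ‖u (latticePoint s n)‖ * ((1 + ‖latticePoint s n‖) ^ k * C) := by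
        gcongr; exact seminorm_translate_le f k m _
    _ = _ := by ring

theorem integral_comp_mul_pi {s : ι → ℝ} (hs : ∀ i, 0 < s i) {F : (ι → ℝ) → ℂ}
    (hF : Continuous F) :
    ∫ x, F x = (∏ i, s i : ℝ) * ∫ y : ι → ℝ, F fun i => s i * y i := by
  classical
  have hdet : (Matrix.diagonal s).det = ∏ i, s i := Matrix.det_diagonal
  have hpos : 0 < ∏ i, s i := Finset.prod_pos fun i _ => hs i
  have h := Real.smul_map_diagonal_volume_pi (D := s) (by rw [hdet]; exact hpos.ne')
  rw [hdet, abs_of_pos hpos] at h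
  conv_lhs => rw [← h]
  have hlin : ⇑(Matrix.toLin' (Matrix.diagonal s)) = fun (y : ι → ℝ) i => s i * y i := by
    ext y i; simp [Matrix.mulVec_diagonal]
  rw [integral_smul_measure, ENNReal.toReal_ofReal hpos.le, hlin,
    integral_map (Continuous.aemeasurable (by fun_prop)) hF.aestronglyMeasurable, Complex.real_smul]

/-- The sampling expansion of a Schwartz function supported in a fundamental box of the dual
lattice. -/
theorem hasSum_fourier_of_support_subset_box {s : ι → ℝ} (hs : ∀ i, 0 < s i)
    (G : 𝓢(EuclideanSpace ℝ ι, ℂ)) (hG : ∀ z, G z ≠ 0 → ∀ i, |z i| ≤ 1 / (2 * s i))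
    {z : EuclideanSpace ℝ ι} (hz : ∀ i, |z i| ≤ 1 / (2 * s i)) :
    HasSum (fun n : ι → ℤ => ((∏ i, s i : ℝ) : ℂ) * 𝓕 G (latticePoint s n) *
      Complex.exp (2 * Real.pi * Complex.I * (inner ℝ (latticePoint s n) z : ℝ))) (G z) := by
  -- Rescaling each coordinate by `s i` turns the box into the unit cube; the Jacobian `∏ i, s i` is
  -- the source of the factor `(ab)^d`.
  let h : (ι → ℝ) → ℂ := fun x => G (WithLp.toLp 2 fun i => x i / s i)
  have hc : Continuous h := by
    refine G.continuous.comp ?_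
    fun_prop
  have hbox : ∀ (i : ι) (t : ℝ), |t / s i| ≤ 1 / (2 * s i) ↔ |t| ≤ 1 / 2 := fun i t => by
    rw [abs_div, abs_of_pos (hs i), one_div, mul_inv, ← div_eq_mul_inv, one_div,
      div_le_div_iff_of_pos_right (hs i)]
  have hsupp : ∀ x, h x ≠ 0 → ∀ i, |x i| ≤ 1 / 2 := fun x hx i => (hbox i _).mp (hG _ hx i)
  have hcoef : ∀ n : ι → ℤ,
      ∫ x : ι → ℝ, Complex.exp (-(2 * Real.pi * Complex.I * (∑ i, n i * x i : ℝ))) * h x =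
        ((∏ i, s i : ℝ) : ℂ) * 𝓕 G (latticePoint s n) := by
    intro n
    rw [integral_comp_mul_pi hs (by fun_prop), SchwartzMap.fourier_apply_eq_integral_cexp,
      ← (PiLp.volume_preserving_toLp ι).integral_comp
        (MeasurableEquiv.toLp 2 (ι → ℝ)).measurableEmbedding]
    congr 1
    refine integral_congr_ae (ae_of_all _ fun y => ?_)
    have h1 : h (fun i => s i * y i) = G (WithLp.toLp 2 y) := by
      simp only [h]
      congr 2
      ext i
      rw [mul_div_cancel_left₀ _ (hs i).ne']
    simp only [h1]
    rw [real_inner_comm, inner_latticePoint]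
  have hsum : Summable fun n : ι → ℤ =>
      ∫ x : ι → ℝ, Complex.exp (-(2 * Real.pi * Complex.I * (∑ i, n i * x i : ℝ))) * h x := by
    have h1 : Summable fun n : ι → ℤ => 𝓕 G (latticePoint s n) :=
      .of_norm (by simpa only [pow_zero, one_mul] using
        summable_pow_mul_norm_latticePoint hs (𝓕 G) 0)
    exact (h1.mul_left _).congr fun n => (hcoef n).symm
  have key := hasSum_fourier_of_support_subset_cube hc hsupp hsum (x := fun i => s i * z i)
    fun i => (hbox i _).mp (by rw [mul_div_cancel_left₀ _ (hs i).ne']; exact hz i)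
  have hval : h (fun i => s i * z i) = G z := by
    simp only [h]
    congr 1
    ext i
    simp [mul_div_cancel_left₀ _ (hs i).ne']
  rw [hval] at key
  simpa only [hcoef, inner_latticePoint] using key

end Series

end ChannelSampling

/-! ### Rihaczek distribution, channel matrix and the lattice box. -/

namespace ChannelSampling

variable {d : ℕ}

@[simp] theorem proj₁_pair (x ξ : Space d) : proj₁ (pair x ξ) = x := rfl

@[simp] theorem proj₂_pair (x ξ : Space d) : proj₂ (pair x ξ) = ξ := rfl

theorem inner_phase (z w : Phase d) :
    (inner ℝ z w : ℝ) = inner ℝ (proj₁ z) (proj₁ w) + inner ℝ (proj₂ z) (proj₂ w) := by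
  simp [PiLp.inner_apply, Fintype.sum_sum_type]

/-- Phase space as a product of measure spaces. -/
noncomputable def pairEquiv (d : ℕ) : Space d × Space d ≃ᵐ Phase d :=
  (((MeasurableEquiv.toLp 2 (Fin d → ℝ)).symm.prodCongr
    (MeasurableEquiv.toLp 2 (Fin d → ℝ)).symm).trans
    (MeasurableEquiv.sumPiEquivProdPi fun _ : Fin d ⊕ Fin d => ℝ).symm).trans
    (MeasurableEquiv.toLp 2 (Fin d ⊕ Fin d → ℝ))

theorem pairEquiv_apply (p : Space d × Space d) : pairEquiv d p = pair p.1 p.2 := by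
  ext i
  rcases i with i | i <;> rfl

theorem measurePreserving_pairEquiv : MeasurePreserving (pairEquiv d) :=
  (((EuclideanSpace.volume_preserving_symm_measurableEquiv_toLp (Fin d)).prod
    (EuclideanSpace.volume_preserving_symm_measurableEquiv_toLp (Fin d))).trans
    (volume_measurePreserving_sumPiEquivProdPi_symm fun _ : Fin d ⊕ Fin d => ℝ)).trans
    (PiLp.volume_preserving_toLp (Fin d ⊕ Fin d))

theorem integral_phase {F : Phase d → ℂ} (hF : Integrable F) :
    ∫ z, F z = ∫ x, ∫ ξ, F (pair x ξ) := by
  have h1 := measurePreserving_pairEquiv.integral_comp (pairEquiv d).measurableEmbedding F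
  have h2 := (measurePreserving_pairEquiv.integrable_comp_emb
    (pairEquiv d).measurableEmbedding).mpr hF
  have h3 : F ∘ pairEquiv d = fun p : Space d × Space d => F (pair p.1 p.2) := by
    ext p; rw [Function.comp_apply, pairEquiv_apply]
  rw [h3] at h2
  rw [← h1]
  simp only [pairEquiv_apply]
  exact integral_prod _ h2

/-- The Fourier transform of the Rihaczek distribution is a rotated short-time Fourier
transform. -/
theorem fourier_rihaczek (f g : 𝓢(Space d, ℂ)) (z : Phase d) :
    𝓕 (rihaczek f g) z = rot (stft g f) z := by
  have hint : Integrable fun w : Phase d =>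
      Complex.exp (-(2 * Real.pi * Complex.I * (inner ℝ w z : ℝ))) * rihaczek f g w := by
    refine (rihaczek f g).integrable.bdd_mul (c := 1)
      (Continuous.aestronglyMeasurable (by fun_prop)) (ae_of_all _ fun w => ?_)
    rw [Complex.norm_exp]; simp
  rw [SchwartzMap.fourier_apply_eq_integral_cexp, integral_phase hint]
  simp only [rot, stft, proj₁_pair, proj₂_pair, rihaczek_apply, inner_phase]
  refine integral_congr_ae (ae_of_all _ fun x => ?_)
  -- The inner integral over `ξ` is Fourier inversion for `g`, up to conjugation and a phase.
  have hg : g (x - -proj₂ z) = ∫ ξ, Complex.exp (2 * Real.pi * Complex.I *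
      (inner ℝ ξ (x + proj₂ z) : ℝ)) * 𝓕 g ξ := by
    rw [← SchwartzMap.fourierInv_apply_eq_integral_cexp, FourierTransform.fourierInv_fourier_eq,
      sub_neg_eq_add]
  simp only [hg]
  rw [← integral_conj, ← integral_const_mul, ← integral_mul_const]
  refine integral_congr_ae (ae_of_all _ fun ξ => ?_)
  simp only [map_mul, ← Complex.exp_conj, Complex.conj_I, Complex.conj_ofReal,
    map_ofNat, inner_add_right]
  rw [real_inner_comm (proj₁ z) x, real_inner_comm ξ x]
  have e1 : Complex.exp (-(2 * Real.pi * Complex.I *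
        ((inner ℝ (proj₁ z) x + inner ℝ ξ (proj₂ z) : ℝ) : ℂ))) *
      Complex.exp (-(2 * Real.pi * Complex.I * ((inner ℝ ξ x : ℝ) : ℂ))) =
      Complex.exp (2 * Real.pi * -Complex.I *
        ((inner ℝ ξ x + inner ℝ ξ (proj₂ z) : ℝ) : ℂ)) *
      Complex.exp (-(2 * Real.pi * Complex.I * ((inner ℝ (proj₁ z) x : ℝ) : ℂ))) := by
    rw [← Complex.exp_add, ← Complex.exp_add]
    congr 1
    push_cast
    ring
  linear_combination (f x * conj (𝓕 g ξ)) * e1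

theorem fourier_tfShift (z : Phase d) (g : 𝓢(Space d, ℂ)) (ξ : Space d) :
    𝓕 (tfShift z g) ξ =
      Complex.exp (-(2 * Real.pi * Complex.I * (inner ℝ (proj₁ z) (ξ - proj₂ z) : ℝ))) *
        𝓕 g (ξ - proj₂ z) := by
  rw [← fourier_translate, SchwartzMap.fourier_apply_eq_integral_cexp,
    SchwartzMap.fourier_apply_eq_integral_cexp]
  refine integral_congr_ae (ae_of_all _ fun t => ?_)
  simp only [tfShift_apply, translate_apply]
  rw [← mul_assoc, ← Complex.exp_add, inner_sub_right, real_inner_comm t (proj₂ z)]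
  congr 2
  push_cast
  ring

/-- Covariance of the Rihaczek distribution under time-frequency shifts. -/
theorem rihaczek_tfShift (l : Phase d) (f g : 𝓢(Space d, ℂ)) :
    rihaczek (tfShift l f) (tfShift l g) = translate l (rihaczek f g) := by
  ext z
  simp only [rihaczek_apply, translate_apply, tfShift_apply, fourier_tfShift, map_sub, map_mul,
    ← Complex.exp_conj, map_neg, Complex.conj_I, Complex.conj_ofReal, map_ofNat]
  have e1 : Complex.exp (2 * Real.pi * Complex.I * ((inner ℝ (proj₂ l) (proj₁ z) : ℝ) : ℂ)) *
      Complex.exp (-(2 * Real.pi * -Complex.I *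
        ((inner ℝ (proj₁ l) (proj₂ z - proj₂ l) : ℝ) : ℂ))) *
      Complex.exp (-(2 * Real.pi * Complex.I * ((inner ℝ (proj₁ z) (proj₂ z) : ℝ) : ℂ))) =
      Complex.exp (-(2 * Real.pi * Complex.I *
        ((inner ℝ (proj₁ z - proj₁ l) (proj₂ z - proj₂ l) : ℝ) : ℂ))) := by
    rw [← Complex.exp_add, ← Complex.exp_add]
    congr 1
    simp only [inner_sub_left, inner_sub_right]
    rw [real_inner_comm (proj₁ z) (proj₂ l)]
    push_cast
    ring
  linear_combination (f (proj₁ z - proj₁ l) * conj (𝓕 g (proj₂ z - proj₂ l))) * e1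

theorem conjS_translate {E : Type*} [NormedAddCommGroup E] [NormedSpace ℝ E] (x : E)
    (f : 𝓢(E, ℂ)) : conjS (translate x f) = translate x (conjS f) := by
  ext; simp

/-- By covariance all diagonal entries probe `σ` with translates of one fixed function. -/
theorem channelMatrix_diag (σ : 𝓢'(Phase d, ℂ)) (g : 𝓢(Space d, ℂ)) (l : Phase d) :
    channelMatrix σ g l l = σ (translate l (conjS (rihaczek g g))) := by
  rw [channelMatrix, bracket_kn, rihaczek_tfShift, bracket, conjS_translate]

/-- The step sizes of the lattice `aℤ^d × bℤ^d`. -/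
def latticeStep (d : ℕ) (a b : ℝ) : Fin d ⊕ Fin d → ℝ := Sum.elim (fun _ => a) fun _ => b

theorem latticeStep_pos {a b : ℝ} (ha : 0 < a) (hb : 0 < b) (i : Fin d ⊕ Fin d) :
    0 < latticeStep d a b i := by
  rcases i with i | i
  exacts [ha, hb]

theorem prod_latticeStep (a b : ℝ) : ∏ i, latticeStep d a b i = (a * b) ^ d := by
  simp [latticeStep, Fintype.prod_sum_type, mul_pow]

/-- Integer coordinates on the lattice `aℤ^d × bℤ^d`. -/
noncomputable def latticeEquiv {a b : ℝ} (ha : 0 < a) (hb : 0 < b) :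
    (Fin d ⊕ Fin d → ℤ) ≃ lattice d a b :=
  Equiv.ofBijective
    (fun n => ⟨latticePoint (latticeStep d a b) n, fun i => n (Sum.inl i), fun i => n (Sum.inr i),
      fun _ => rfl, fun _ => rfl⟩)
    ⟨fun _ _ h => latticePoint_injective (latticeStep_pos ha hb) (congrArg Subtype.val h), by
      rintro ⟨z, k, l, hk, hl⟩
      refine ⟨Sum.elim k l, Subtype.ext ?_⟩
      ext i
      rcases i with i | i
      · exact (hk i).symm
      · exact (hl i).symm⟩

theorem coe_latticeEquiv {a b : ℝ} (ha : 0 < a) (hb : 0 < b) (n : Fin d ⊕ Fin d → ℤ) :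
    (latticeEquiv ha hb n : Phase d) = latticePoint (latticeStep d a b) n := rfl

theorem mem_rect_iff {a b ε : ℝ} {z : Phase d} :
    z ∈ rect d a b ε ↔ ∀ i, |z i| ≤ 1 / (2 * latticeStep d a b i) - ε := by
  simp only [rect, Set.mem_ofPred_eq, Set.mem_Icc, Sum.forall, latticeStep, Sum.elim_inl,
    Sum.elim_inr, abs_le, sub_eq_add_neg, neg_add, neg_neg]

/-- The upper bounds on `ε` make all half-widths positive, so a factor `r < 1` moves even boundary
points strictly inside. -/
theorem eventually_smul_mem_rect {a b ε : ℝ} (hεa : ε < 1 / (2 * a)) (hεb : ε < 1 / (2 * b))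
    {r : ℝ} (hr0 : 0 ≤ r) (hr1 : r < 1) {z : Phase d} (hz : z ∈ rect d a b ε) :
    ∀ᶠ y in 𝓝 z, r • y ∈ rect d a b ε := by
  rw [mem_rect_iff] at hz
  have hpos : ∀ i, 0 < 1 / (2 * latticeStep d a b i) - ε := by
    rintro (i | i)
    · exact sub_pos.mpr hεa
    · exact sub_pos.mpr hεb
  have h : ∀ i, ∀ᶠ y : Phase d in 𝓝 z, |(r • y) i| < 1 / (2 * latticeStep d a b i) - ε := by
    intro i
    have hc : Continuous fun y : Phase d => |(r • y) i| := by fun_prop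
    refine hc.continuousAt.eventually_lt continuousAt_const ?_
    rw [PiLp.smul_apply, smul_eq_mul, abs_mul, abs_of_nonneg hr0]
    nlinarith [hz i, hpos i, abs_nonneg (z i)]
  filter_upwards [eventually_all.mpr h] with y hy
  exact mem_rect_iff.mpr fun i => (hy i).le

/-- Off the closed support of `φ` the quotient is locally zero, so zeros of `w` there are harmless.
-/
theorem contDiff_div_of_ne_zero_on_tsupport {E : Type*} [NormedAddCommGroup E] [NormedSpace ℝ E]
    {φ w : E → ℂ} {n : ℕ∞ω} (hφ : ContDiff ℝ n φ) (hw : ContDiff ℝ n w)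
    (h : ∀ z ∈ tsupport φ, w z ≠ 0) : ContDiff ℝ n fun z => φ z / w z := by
  rw [contDiff_iff_contDiffAt]
  intro z
  by_cases hz : z ∈ tsupport φ
  · simp only [div_eq_mul_inv]
    exact hφ.contDiffAt.mul (hw.contDiffAt.inv (h z hz))
  · refine (contDiffAt_const (c := (0 : ℂ))).congr_of_eventuallyEq ?_
    filter_upwards [notMem_tsupport_iff_eventuallyEq.mp hz] with y hy
    simp [hy]

end ChannelSampling

/-! ### The reconstruction formula. -/

theorem proposition2 (d : ℕ) (a b ε : ℝ) (ha : 0 < a) (hb : 0 < b)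
    (hε : 0 < ε) (hεa : ε < 1 / (2 * a)) (hεb : ε < 1 / (2 * b))
    (σ : 𝓢'(Phase d, ℂ)) (hσ : Distribution.dsupport (𝓕 σ : 𝓢'(Phase d, ℂ)) ⊆ rect d a b ε)
    (g : 𝓢(Space d, ℂ))
    (φ : Phase d → ℂ) (hφ : ContDiff ℝ ∞ φ) (hφc : HasCompactSupport φ)
    (hφ1 : ∀ z ∈ rect d a b ε, φ z = 1) (hφQ : tsupport φ ⊆ rect d a b 0)
    (hg : ∀ z ∈ tsupport φ, conj (rot (stft g g) z) ≠ 0) :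
    ∃ K : 𝓢(Phase d, ℂ),
      (K : Phase d → ℂ) = 𝓕⁻ (fun z : Phase d => φ z / conj (rot (stft g g) z)) ∧
      HasSum
        (fun l : lattice d a b =>
          (((a * b) ^ d : ℝ) : ℂ) • channelMatrix σ g l l •
            ((translate (l : Phase d) K : 𝓢(Phase d, ℂ)) : 𝓢'(Phase d, ℂ)))
        σ := by
  have hrot : ∀ z, conj (rot (stft g g) z) = conjS (𝓕 (rihaczek g g)) z := fun z => by
    rw [conjS_apply, fourier_rihaczek]
  have hsmooth : ContDiff ℝ ∞ fun z => φ z / conj (rot (stft g g) z) := by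
    refine ChannelSampling.contDiff_div_of_ne_zero_on_tsupport hφ ?_ hg
    simp only [hrot]
    exact (conjS (𝓕 (rihaczek g g))).smooth ⊤
  have hcomp : HasCompactSupport fun z => φ z / conj (rot (stft g g) z) := by
    simp only [div_eq_mul_inv]
    exact hφc.mul_right
  let k : 𝓢(Phase d, ℂ) := hcomp.toSchwartzMap hsmooth
  have hk : ∀ z, k z = φ z / conj (rot (stft g g) z) := fun _ => rfl
  have hs := latticeStep_pos (d := d) ha hb
  refine ⟨𝓕⁻ k, SchwartzMap.fourierInv_coe k, ?_⟩
  -- The topology on tempered distributions is that of pointwise convergence, so one test function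
  -- `ψ` is treated at a time.
  rw [HasSum, PointwiseConvergenceCLM.tendsto_iff_forall_tendsto]
  intro ψ
  let G : 𝓢(Phase d, ℂ) := mulS k (𝓕⁻ ψ)
  obtain ⟨Ψ, hΨ⟩ := exists_hasSum_smul_translate hs (𝓕 G) (conjS (rihaczek g g))
  have hG : ∀ z, G z ≠ 0 → ∀ i, |z i| ≤ 1 / (2 * latticeStep d a b i) := by
    intro z hz i
    have hφz : φ z ≠ 0 := fun h => hz (by simp [G, hk, h])
    simpa using mem_rect_iff.mp (hφQ (subset_tsupport φ hφz)) i
  have hvanish : ∀ z ∈ rect d a b ε,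
      𝓕⁻ ((((a * b) ^ d : ℝ) : ℂ) • Ψ - ψ) z = 0 := by
    intro z hz
    have hz' : ∀ i, |z i| ≤ 1 / (2 * latticeStep d a b i) := fun i =>
      (mem_rect_iff.mp hz i).trans (sub_le_self _ hε.le)
    have h1 := hasSum_fourier_of_support_subset_box hs G hG hz'
    have h2 : HasSum (fun n : Fin d ⊕ Fin d → ℤ => 𝓕 G (latticePoint (latticeStep d a b) n) *
        (Complex.exp (2 * Real.pi * Complex.I *
          (inner ℝ (latticePoint (latticeStep d a b) n) z : ℝ)) *
          conj (rot (stft g g) z))) (𝓕⁻ Ψ z) := by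
      -- Evaluation at `z` after `𝓕⁻` is continuous on Schwartz space, so it passes through the
      -- series for `Ψ`.
      refine ((TemperedDistribution.delta z).hasSum_apply
        (hΨ.mapL (FourierTransform.fourierInvCLM ℂ 𝓢(Phase d, ℂ)))).congr_fun fun n => ?_
      rw [TemperedDistribution.delta_apply, map_smul, FourierTransform.fourierInvCLM_apply,
        smul_apply, smul_eq_mul, fourierInv_translate, fourierInv_conjS, fourier_rihaczek]
    -- Both series have the same terms: the Fourier series of `G` at `z`, times `conj (rot (stft g
    -- g) z)`.
    have h3 := (h2.mul_left (((a * b) ^ d : ℝ) : ℂ)).unique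
      ((h1.mul_right (conj (rot (stft g g) z))).congr_fun fun n => by
        rw [prod_latticeStep]; ring)
    have hφz := hφ1 z hz
    have hne := hg z (subset_tsupport φ (by rw [Function.mem_support, hφz]; exact one_ne_zero))
    have hGz : G z * conj (rot (stft g g) z) = 𝓕⁻ ψ z := by
      simp only [G, mulS_apply, hk, hφz]
      field_simp
    rw [hGz] at h3
    rw [← FourierTransform.fourierInvCLM_apply (R := ℂ), map_sub, map_smul, sub_apply, smul_apply,
      FourierTransform.fourierInvCLM_apply, FourierTransform.fourierInvCLM_apply, smul_eq_mul, h3,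
      sub_self]
  have hzero : σ ((((a * b) ^ d : ℝ) : ℂ) • Ψ - ψ) = 0 := by
    -- The value of `𝓕 σ` on `𝓕⁻ u` is `σ u`, so the support hypothesis on `𝓕 σ` applies.
    have := TemperedDistribution.apply_eq_zero_of_starShaped (𝓕 σ) hσ
      (fun r hr hr1 z hz => eventually_smul_mem_rect hεa hεb (by linarith) hr1 hz) _ hvanish
    rwa [TemperedDistribution.fourier_apply, FourierTransform.fourier_fourierInv_eq] at this
  have hsum : HasSum (fun l : lattice d a b => ((((a * b) ^ d : ℝ) : ℂ) • channelMatrix σ g l l •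
      ((translate (l : Phase d) (𝓕⁻ k) : 𝓢(Phase d, ℂ)) : 𝓢'(Phase d, ℂ))) ψ) (σ ψ) := by
    rw [← (latticeEquiv ha hb).hasSum_iff]
    have h1 := (σ.hasSum_apply hΨ).mul_left (((a * b) ^ d : ℝ) : ℂ)
    rw [map_sub, map_smul, smul_eq_mul, sub_eq_zero] at hzero
    rw [hzero] at h1
    refine h1.congr_fun fun n => ?_
    have h2 : ((translate (latticePoint (latticeStep d a b) n) (𝓕⁻ k) : 𝓢(Phase d, ℂ)) :
        𝓢'(Phase d, ℂ)) ψ = 𝓕 G (latticePoint (latticeStep d a b) n) := by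
      rw [SchwartzMap.coe_apply, ← integral_mul_translate_fourierInv]
      rfl
    simp only [Function.comp_apply, coe_latticeEquiv, smul_apply, h2,
      channelMatrix_diag, map_smul, smul_eq_mul]
    ring
  rw [HasSum] at hsum
  refine hsum.congr fun s => ?_
  simp
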